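/- Let $\delta_1<\delta_2$ be real, let $Y=\{y_{(1)}<\dots<y_{(m)}\}\subset(\delta_1,\delta_2)$ be a set of $m\ge 1$ distinct points, put $y_{(0)}=\delta_1$, $y_{(m+1)}=\delta_2$ and $I_i=(y_{(i-1)},y_{(i)})$ for $1\le i\le m+1$. The intervals $I_2,\dots,I_m$ are called middle intervals, $I_1$ and $I_{m+1}$ end intervals. Let $\tau\in(0,\infty)$ and $c\in(0,1)$. Proximity regions. For $x$ in a middle interval $(a,b)$, with $M_c=a+c(b-a)$, let $$N(x,\tau,c)=\begin{cases}\left(x-\tau(x-a),\ x+\frac{\tau(1-c)(x-a)}{c}\right)\cap(a,b), & x\le M_c,\\[2pt] \left(x-\frac{c\tau(b-x)}{1-c},\ x+\tau(b-x)\right)\cap(a,b), & x>M_c.\end{cases}$$ For $x\in I_1$ let $N_e(x,\tau)=(x-\tau(y_{(1)}-x),\,x+\tau(y_{(1)}-x))\cap(-\infty,y_{(1)})$, and for $x\in I_{m+1}$ let $N_e(x,\tau)=(x-\tau(x-y_{(m)}),\,x+\tau(x-y_{(m)}))\cap(y_{(m)},\infty)$. Let $X_1,X_2,\dots$ be i.i.d.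 uniform on $(\delta_1,\delta_2)$. For a sample size $n$, let $D_{[i]}(\tau,c)$ be the digraph whose vertices are those of $X_1,\dots,X_n$ that lie in $I_i$, with an arc from $X_k$ to $X_l$ ($k\ne l$) if and only if $X_l$ lies in the proximity region of $X_k$. Let $n_i$ be its (random) number of vertices and let $\rho_{[i]}(\tau,c)$ be its relative density, that is, its number of arcs divided by $n_i(n_i-1)$ (and $0$ if $n_i\le1$). For a region map $R$ on an interval $(a,b)$ and independent $U_1,U_2,U_3$ uniform on $(a,b)$, call $P(U_2\in R(U_1))$ the arc probability and $\operatorname{Cov}[h_{12},h_{13}]$ the arc covariance, where $h_{jk}=\tfrac12\left(\mathbf 1\{U_k\in R(U_j)\}+\mathbf 1\{U_j\in R(U_k)\}\right)$. Let $\mu(\tau,c)$ and $\nu(\tau,c)$ be the arc probability and the arc covariance of the region $N(\cdot,\tau,c)$ on the middle interval $(0,1)$, and let $\mu_e(\tau)$ and $\nu_e(\tau)$ be those of the region $N_e(\cdot,\tau)$ on the right end interval $(0,1)$ (with $y_{(m)}=0$). Then: (i) For every $i\in\{2,\dots,m\}$: the arc probability and the arc covariance of $N(\cdot,\tau,c)$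 on $I_i$ are $\mu(\tau,c)$ and $\nu(\tau,c)$; $\nu(\tau,c)>0$; $E[\rho_{[i]}(\tau,c)\mid n_i=k]=\mu(\tau,c)$ whenever $2\le k\le n$; and $$\sqrt{n_i}\,\left[\rho_{[i]}(\tau,c)-\mu(\tau,c)\right]\ \xrightarrow{\ \mathcal L\ }\ \mathcal N(0,4\nu(\tau,c))\qquad\text{as } n_i\to\infty .$$ (ii) For $i\in\{1,m+1\}$ the same holds with $N_e(\cdot,\tau)$, $\mu_e(\tau)$, $\nu_e(\tau)$ in place of $N(\cdot,\tau,c)$, $\mu(\tau,c)$, $\nu(\tau,c)$. In particular $\nu_e(\tau)>0$ and $$\sqrt{n_i}\,\left[\rho_{[i]}(\tau,c)-\mu_e(\tau)\right]\ \xrightarrow{\ \mathcal L\ }\ \mathcal N(0,4\nu_e(\tau))\qquad\text{as } n_i\to\infty .$$ Here convergence as $n_i\to\infty$ is meant in both of the following senses: conditionally, i.e. the conditional laws given $n_i=k_j$ for sample sizes $s_j\ge k_j$ converge weakly whenever $k_j\to\infty$; and unconditionally, i.e. with $n_i$ the random number of sample points in $I_i$, as the sample size $n\to\infty$. -/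

import Mathlib

open MeasureTheory ProbabilityTheory Filter Set
open scoped Topology BoundedContinuousFunction

noncomputable section

namespace CentralSimilarity

/-! ### Proximity regions -/

/-- Central similarity proximity region `N(x, τ, c)` of a point `x` of a middle interval `(a, b)`.
The dividing point is `M_c = a + c (b - a)`; at `x = M_c` the two formulas agree. -/
def midRegion (a b τ c x : ℝ) : Set ℝ :=
  if x ≤ a + c * (b - a) then
    Ioo (x - τ * (x - a)) (x + τ * (1 - c) * (x - a) / c) ∩ Ioo a b
  else
    Ioo (x - c * τ * (b - x) / (1 - c)) (x + τ * (b - x)) ∩ Ioo a b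

/-- Proximity region `N_e(x, τ)` of a point `x < b` of the left end interval, which ends at `b`. -/
def leftEndRegion (b τ x : ℝ) : Set ℝ :=
  Ioo (x - τ * (b - x)) (x + τ * (b - x)) ∩ Iio b

/-- Proximity region `N_e(x, τ)` of a point `x > a` of the right end interval, which starts
at `a`. -/
def rightEndRegion (a τ x : ℝ) : Set ℝ :=
  Ioo (x - τ * (x - a)) (x + τ * (x - a)) ∩ Ioi a

/-! ### The partition of `(δ₁, δ₂)` by the points of `Y` -/

/-- The order statistics `y₍₁₎ < ⋯ < y₍ₘ₎` of the `m` points of `Y`, extended by `y₍₀₎ = δ₁` and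
`y₍ₘ₊₁₎ = δ₂`. -/
def orderStat (δ₁ δ₂ : ℝ) (Y : Finset ℝ) (i : ℕ) : ℝ :=
  if i = 0 then δ₁
  else if h : i - 1 < Y.card then Y.orderEmbOfFin rfl ⟨i - 1, h⟩
  else δ₂

/-- The `i`-th interval `(y₍ᵢ₋₁₎, y₍ᵢ₎)`, for `1 ≤ i ≤ m + 1`. -/
def cell (δ₁ δ₂ : ℝ) (Y : Finset ℝ) (i : ℕ) : Set ℝ :=
  Ioo (orderStat δ₁ δ₂ Y (i - 1)) (orderStat δ₁ δ₂ Y i)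

/-- The proximity region of a point `x` of the `i`-th interval: `i = 1` and `i = m + 1` are the
end intervals, `2 ≤ i ≤ m` the middle intervals. -/
def proxRegion (δ₁ δ₂ : ℝ) (Y : Finset ℝ) (τ c : ℝ) (i : ℕ) (x : ℝ) : Set ℝ :=
  if i = 1 then leftEndRegion (orderStat δ₁ δ₂ Y 1) τ x
  else if i = Y.card + 1 then rightEndRegion (orderStat δ₁ δ₂ Y Y.card) τ x
  else midRegion (orderStat δ₁ δ₂ Y (i - 1)) (orderStat δ₁ δ₂ Y i) τ c x

/-! ### The component digraphs and their relative density -/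

/-- The component `D_[i](τ, c)`, for the data points `x 0, …, x (n - 1)`: its vertices are the
data points in the `i`-th interval, with an arc from `x k` to `x l` when `x l ∈ N(x k)`. -/
def component (δ₁ δ₂ : ℝ) (Y : Finset ℝ) (τ c : ℝ) (i : ℕ) {n : ℕ} (x : Fin n → ℝ) :
    Digraph {k : Fin n // x k ∈ cell δ₁ δ₂ Y i} where
  Adj k l := x l ∈ proxRegion δ₁ δ₂ Y τ c i (x k)

/-- Relative density of a finite digraph: the number of arcs (loops are not counted) divided by
`|V| (|V| - 1)`. It is `0` when there are fewer than two vertices. -/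
def relDensity {V : Type*} (G : Digraph V) : ℝ :=
  (Nat.card {p : V × V // p.1 ≠ p.2 ∧ G.Adj p.1 p.2} : ℝ) /
    ((Nat.card V : ℝ) * ((Nat.card V : ℝ) - 1))

variable {Ω : Type*}

/-- `nᵢ`: the number of the points `X 0, …, X (n - 1)` that lie in the `i`-th interval. -/
def cellCount (δ₁ δ₂ : ℝ) (Y : Finset ℝ) (i : ℕ) (X : ℕ → Ω → ℝ) (n : ℕ) (ω : Ω) : ℕ :=
  Nat.card {k : Fin n // X k ω ∈ cell δ₁ δ₂ Y i}

/-- `ρ_[i](τ, c)`: the relative density of the `i`-th component on the vertices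
`X 0, …, X (n - 1)`. -/
def rho (δ₁ δ₂ : ℝ) (Y : Finset ℝ) (τ c : ℝ) (i : ℕ) (X : ℕ → Ω → ℝ) (n : ℕ) (ω : Ω) : ℝ :=
  relDensity (component δ₁ δ₂ Y τ c i (fun k : Fin n => X k ω))

/-! ### Arc probability and covariance -/

/-- The uniform distribution on `(a, b)`. -/
def unif (a b : ℝ) : Measure ℝ := ProbabilityTheory.cond volume (Ioo a b)

/-- The arc probability `P(X₂ ∈ N(X₁))` for independent `X₁, X₂` uniform on `(a, b)`. -/
def arcProb (N : ℝ → Set ℝ) (a b : ℝ) : ℝ :=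
  ((unif a b).prod (unif a b)).real {p | p.2 ∈ N p.1}

open Classical in
/-- The symmetric kernel `h(x, z) = (I(z ∈ N(x)) + I(x ∈ N(z))) / 2`. -/
def arcKernel (N : ℝ → Set ℝ) (x z : ℝ) : ℝ :=
  ((if z ∈ N x then 1 else 0) + (if x ∈ N z then 1 else 0)) / 2

/-- `Cov[h₁₂, h₁₃]`, where `h_{jk} = h(X_j, X_k)`, for independent `X₁, X₂, X₃` uniform
on `(a, b)`. -/
def arcCov (N : ℝ → Set ℝ) (a b : ℝ) : ℝ :=
  covariance (fun p : ℝ × ℝ × ℝ => arcKernel N p.1 p.2.1)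
    (fun p : ℝ × ℝ × ℝ => arcKernel N p.1 p.2.2)
    ((unif a b).prod ((unif a b).prod (unif a b)))

/-- `μ(τ, c)`: arc probability for the middle interval `(0, 1)`. -/
def mu (τ c : ℝ) : ℝ := arcProb (midRegion 0 1 τ c) 0 1

/-- `ν(τ, c)`: covariance `Cov[h₁₂, h₁₃]` for the middle interval `(0, 1)`. -/
def nu (τ c : ℝ) : ℝ := arcCov (midRegion 0 1 τ c) 0 1

/-- `μ_e(τ)`: arc probability for the (right) end interval `(0, 1)`. -/
def muEnd (τ : ℝ) : ℝ := arcProb (rightEndRegion 0 τ) 0 1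

/-- `ν_e(τ)`: covariance `Cov[h₁₂, h₁₃]` for the (right) end interval `(0, 1)`. -/
def nuEnd (τ : ℝ) : ℝ := arcCov (rightEndRegion 0 τ) 0 1

/-! ### Asymptotic normality as `nᵢ → ∞` -/

/-- Conditionally on `nᵢ`, the law of `√nᵢ (ρ_[i](τ, c) - μ)` tends to `N(0, v)` as `nᵢ → ∞`:
for all sample sizes `s j` and all values `k j ≤ s j` of `nᵢ` with `k j → ∞`, the conditional laws
given `nᵢ = k j` converge weakly. -/
def CondNormalLimit [MeasurableSpace Ω] (P : Measure Ω) (X : ℕ → Ω → ℝ) (δ₁ δ₂ : ℝ) (Y : Finset ℝ)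
    (τ c : ℝ) (i : ℕ) (μ v : ℝ) : Prop :=
  ∀ s k : ℕ → ℕ, (∀ j, k j ≤ s j) → Tendsto k atTop atTop →
    ∀ f : ℝ →ᵇ ℝ,
      Tendsto
        (fun j => ∫ ω, f (√(cellCount δ₁ δ₂ Y i X (s j) ω : ℝ) *
            (rho δ₁ δ₂ Y τ c i X (s j) ω - μ))
          ∂(ProbabilityTheory.cond P {ω | cellCount δ₁ δ₂ Y i X (s j) ω = k j}))
        atTop (𝓝 (∫ t, f t ∂(gaussianReal 0 v.toNNReal)))

/-- Unconditionally, with `nᵢ` the random number of points in the `i`-th interval: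
`√nᵢ (ρ_[i](τ, c) - μ)` converges in law to `N(0, v)` as the sample size tends to infinity. -/
def NormalLimit [MeasurableSpace Ω] (P : Measure Ω) [IsProbabilityMeasure P] (X : ℕ → Ω → ℝ)
    (δ₁ δ₂ : ℝ) (Y : Finset ℝ) (τ c : ℝ) (i : ℕ) (μ v : ℝ) : Prop :=
  TendstoInDistribution
    (fun (n : ℕ) (ω : Ω) => √(cellCount δ₁ δ₂ Y i X n ω : ℝ) * (rho δ₁ δ₂ Y τ c i X n ω - μ))
    atTop (id : ℝ → ℝ) (fun _ => P) (gaussianReal 0 v.toNNReal)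

/-- `E[ρ_[i](τ, c) | nᵢ = k] = μ` for every sample size `n` and every value `2 ≤ k ≤ n`. -/
def CondMeanEq [MeasurableSpace Ω] (P : Measure Ω) (X : ℕ → Ω → ℝ) (δ₁ δ₂ : ℝ) (Y : Finset ℝ)
    (τ c : ℝ) (i : ℕ) (μ : ℝ) : Prop :=
  ∀ n k : ℕ, 2 ≤ k → k ≤ n →
    ∫ ω, rho δ₁ δ₂ Y τ c i X n ω
      ∂(ProbabilityTheory.cond P {ω | cellCount δ₁ δ₂ Y i X n ω = k}) = μ

end CentralSimilarity

end

/-! The relative density of a component is a U-statistic of order two in its vertices, with the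
bounded symmetric kernel `arcKernel`. Given which sample points fall in a cell, those points are
i.i.d. uniform on it; so given `nᵢ = k` the density is distributed as the U-statistic of `k` i.i.d.
uniform points (`map_cond_densityIn`), whatever the sample size. The conditional mean is then
unbiasedness, and the conditional limit is Hoeffding's central limit theorem
(`tendstoInDistribution_uStat`): replacing the kernel by its first-order projection leaves a
degenerate sum whose variance is of lower order.

The unconditional limit comes from averaging: the expectation of a bounded continuous test function
is that of a deterministic, convergent function of `nᵢ`, and `nᵢ → ∞` almost surely by the strong
law, so dominated convergence applies (`tendstoInDistribution_densityIn`).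

The constants do not depend on the cell because the regions commute with affine maps onto it, a
reflection taking the left end interval to the right one (`arcProb_transport`, `arcCov_transport`).
The arc covariance is the variance of the projection (`covariance_kernel`), which is half the sum of
the out-arc and in-arc probabilities of a point. It is positive because this sum stays below a
constant on one interval and above a larger one on another (`nu_pos`, `nuEnd_pos`). -/

noncomputable section
-- Projections of a kernel and the second moment of degenerate sums.
namespace UStatistic

variable {α Ω ι : Type*} [MeasurableSpace α] [MeasurableSpace Ω]

/-- The first-order projection `x ↦ E[H(x, Y)]` of a kernel `H`, with `Y` of law `Q`. -/
def proj (Q : Measure α) (H : α → α → ℝ) (x : α) : ℝ := ∫ y, H x y ∂Q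

/-- The completely degenerate part of a kernel in its Hoeffding decomposition. -/
def degen (Q : Measure α) (H : α → α → ℝ) (x y : α) : ℝ :=
  H x y - proj Q H x - proj Q H y + ∫ z, proj Q H z ∂Q

variable {Q : Measure α} [IsProbabilityMeasure Q] {H : α → α → ℝ}

lemma integrable_of_abs_le {P : Measure Ω} [IsFiniteMeasure P] {f : Ω → ℝ} {C : ℝ}
    (hf : Measurable f) (hC : ∀ x, |f x| ≤ C) : Integrable f P :=
  Integrable.of_bound hf.aestronglyMeasurable C (Eventually.of_forall hC)

lemma abs_integral_le_of_abs_le {f : α → ℝ} {C : ℝ} (hC : ∀ x, |f x| ≤ C) :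
    |∫ x, f x ∂Q| ≤ C := by
  simpa using norm_integral_le_of_norm_le_const (μ := Q) (f := f) (Eventually.of_forall hC)

lemma measurable_proj (hH : Measurable (Function.uncurry H)) : Measurable (proj Q H) :=
  (hH.stronglyMeasurable.integral_prod_right (ν := Q)).measurable

lemma abs_proj_le {C : ℝ} (hC : ∀ x y, |H x y| ≤ C) (x : α) : |proj Q H x| ≤ C :=
  abs_integral_le_of_abs_le (hC x)

lemma measurable_degen (hH : Measurable (Function.uncurry H)) :
    Measurable (Function.uncurry (degen Q H)) := by
  have h1 := measurable_proj (Q := Q) hH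
  exact ((hH.sub (h1.comp measurable_fst)).sub (h1.comp measurable_snd)).add_const _

omit [IsProbabilityMeasure Q] in
lemma degen_symm (hs : ∀ x y, H x y = H y x) (x y : α) : degen Q H x y = degen Q H y x := by
  simp only [degen, hs x y]; ring

lemma abs_degen_le {C : ℝ} (hC : ∀ x y, |H x y| ≤ C) (x y : α) : |degen Q H x y| ≤ 4 * C := by
  have h1 := abs_le.1 (hC x y)
  have h2 := abs_le.1 (abs_proj_le (Q := Q) hC x)
  have h3 := abs_le.1 (abs_proj_le (Q := Q) hC y)
  have h4 := abs_le.1 (abs_integral_le_of_abs_le (Q := Q) (abs_proj_le (Q := Q) hC))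
  rw [abs_le, degen]
  constructor <;> linarith

lemma integral_degen (hH : Measurable (Function.uncurry H)) {C : ℝ} (hC : ∀ x y, |H x y| ≤ C)
    (x : α) : ∫ y, degen Q H x y ∂Q = 0 := by
  have i1 : Integrable (H x) Q := integrable_of_abs_le hH.of_uncurry_left (hC x)
  have i2 : Integrable (proj Q H) Q := integrable_of_abs_le (measurable_proj hH) (abs_proj_le hC)
  have i3 : Integrable (fun y => H x y - proj Q H x) Q := i1.sub (integrable_const _)
  have i4 : Integrable (fun y => H x y - proj Q H x - proj Q H y) Q := i3.sub i2
  simp only [degen]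
  rw [integral_add i4 (integrable_const _), integral_sub i3 i2,
    integral_sub i1 (integrable_const _)]
  simp [proj]

variable {P : Measure Ω} [IsProbabilityMeasure P] {U : ι → Ω → α}

/-- Two terms of a sum over pairs of independent variables are orthogonal when the kernel is
degenerate and one of the pairs has an index that the other does not have. -/
lemma integral_mul_eq_zero_of_degenerate {G : α → α → ℝ} (hG : Measurable (Function.uncurry G))
    {C : ℝ} (hC : ∀ x y, |G x y| ≤ C) (h0 : ∀ y, ∫ x, G x y ∂Q = 0)
    (hU : ∀ i, Measurable (U i)) (hind : iIndepFun U P) (hlaw : ∀ i, P.map (U i) = Q)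
    {i j k l : ι} (hki : k ≠ i) (hkj : k ≠ j) (hkl : k ≠ l) :
    ∫ ω, G (U i ω) (U j ω) * G (U k ω) (U l ω) ∂P = 0 := by
  classical
  -- Only `k` has to be new: `i`, `j`, `l` may coincide, so they are kept together as one triple
  -- independent of `U k`.
  have hd : Disjoint ({k} : Finset ι) {i, j, l} := by
    simp [hki, hkj, hkl]
  have h1 := hind.indepFun_finset {k} {i, j, l} hd hU
  have h2 : IndepFun (U k) (fun ω => (U i ω, U j ω, U l ω)) P :=
    h1.comp (φ := fun f : ({k} : Finset ι) → α => f ⟨k, by simp⟩)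
      (ψ := fun f : ({i, j, l} : Finset ι) → α =>
        (f ⟨i, by simp⟩, f ⟨j, by simp⟩, f ⟨l, by simp⟩))
      (by fun_prop) (by fun_prop)
  have hT : Measurable (fun ω => (U i ω, U j ω, U l ω)) := by fun_prop
  have h3 := (indepFun_iff_map_prod_eq_prod_map_map (hU k).aemeasurable hT.aemeasurable).1 h2
  let F : α × α × α × α → ℝ := fun p => G p.2.1 p.2.2.1 * G p.1 p.2.2.2
  have hF : Measurable F := by
    have a : Measurable fun p : α × α × α × α => G p.2.1 p.2.2.1 :=
      hG.comp (g := Function.uncurry G) (f := fun p : α × α × α × α => (p.2.1, p.2.2.1))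
        (by fun_prop)
    have b : Measurable fun p : α × α × α × α => G p.1 p.2.2.2 :=
      hG.comp (g := Function.uncurry G) (f := fun p : α × α × α × α => (p.1, p.2.2.2))
        (by fun_prop)
    exact a.mul b
  have hFC : ∀ p, |F p| ≤ C * C := fun p => by
    rw [abs_mul]
    exact mul_le_mul (hC _ _) (hC _ _) (abs_nonneg _) ((abs_nonneg _).trans (hC p.1 p.1))
  have : IsProbabilityMeasure (P.map fun ω => (U i ω, U j ω, U l ω)) :=
    Measure.isProbabilityMeasure_map hT.aemeasurable
  calc ∫ ω, G (U i ω) (U j ω) * G (U k ω) (U l ω) ∂P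
      = ∫ p, F p ∂(P.map fun ω => (U k ω, U i ω, U j ω, U l ω)) :=
        (integral_map ((hU k).prodMk hT).aemeasurable hF.aestronglyMeasurable).symm
    _ = 0 := by
        -- The integral over the value of `U k` is taken first; degeneracy makes it vanish for every
        -- fixed triple.
        rw [h3, hlaw, integral_prod_symm _ (integrable_of_abs_le hF hFC)]
        simp [F, integral_const_mul, h0]

/-- The second moment of a sum of a degenerate kernel over the ordered pairs from `s`. -/
lemma integral_sq_sum_offDiag_le [DecidableEq ι] {G : α → α → ℝ}
    (hG : Measurable (Function.uncurry G)) (hs : ∀ x y, G x y = G y x)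
    {C : ℝ} (hC : ∀ x y, |G x y| ≤ C) (h0 : ∀ x, ∫ y, G x y ∂Q = 0)
    (hU : ∀ i, Measurable (U i)) (hind : iIndepFun U P) (hlaw : ∀ i, P.map (U i) = Q)
    (s : Finset ι) :
    ∫ ω, (∑ p ∈ s.offDiag, G (U p.1 ω) (U p.2 ω)) ^ 2 ∂P ≤ s.offDiag.card * (2 * C ^ 2) := by
  have h0' : ∀ y, ∫ x, G x y ∂Q = 0 := fun y => by simpa only [hs _ y] using h0 y
  have hm : ∀ i j, Measurable fun ω => G (U i ω) (U j ω) := fun i j =>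
    hG.comp (g := Function.uncurry G) (f := fun ω => (U i ω, U j ω)) (by fun_prop)
  have hb : ∀ i j k l ω, |G (U i ω) (U j ω) * G (U k ω) (U l ω)| ≤ C ^ 2 := fun i j k l ω => by
    rw [abs_mul, sq]
    exact mul_le_mul (hC _ _) (hC _ _) (abs_nonneg _) ((abs_nonneg _).trans (hC (U i ω) (U i ω)))
  have hint : ∀ i j k l, Integrable (fun ω => G (U i ω) (U j ω) * G (U k ω) (U l ω)) P :=
    fun i j k l => integrable_of_abs_le ((hm i j).mul (hm k l)) (hb i j k l)
  -- Two ordered pairs contribute only if they have the same underlying set, so each row of the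
  -- double sum has at most two nonzero entries.
  have key : ∀ p ∈ s.offDiag, ∀ q ∈ s.offDiag,
      ∫ ω, G (U p.1 ω) (U p.2 ω) * G (U q.1 ω) (U q.2 ω) ∂P
        ≤ (if q = p then C ^ 2 else 0) + (if q = p.swap then C ^ 2 else 0) := by
    rintro ⟨i, j⟩ hp ⟨k, l⟩ hq
    rw [Finset.mem_offDiag] at hp hq
    obtain ⟨-, -, hij⟩ := hp
    obtain ⟨-, -, hkl⟩ := hq
    simp only [ne_eq] at hij hkl
    have hle := (abs_le.1 (abs_integral_le_of_abs_le (Q := P) (hb i j k l))).2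
    have hC2 := sq_nonneg C
    by_cases hk : k ≠ i ∧ k ≠ j
    · rw [integral_mul_eq_zero_of_degenerate hG hC h0' hU hind hlaw hk.1 hk.2 hkl]
      positivity
    by_cases hl : l ≠ i ∧ l ≠ j
    · have := integral_mul_eq_zero_of_degenerate hG hC h0' hU hind hlaw hl.1 hl.2 (Ne.symm hkl)
      simp only [hs (U l _) (U k _)] at this
      rw [this]
      positivity
    · have : (k = i ∧ l = j) ∨ (k = j ∧ l = i) := by grind
      rcases this with ⟨rfl, rfl⟩ | ⟨rfl, rfl⟩
      · simp only [if_true]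
        refine hle.trans (le_add_of_nonneg_right ?_)
        positivity
      · simp only [Prod.swap_prod_mk, if_true]
        refine hle.trans (le_add_of_nonneg_left ?_)
        positivity
  calc ∫ ω, (∑ p ∈ s.offDiag, G (U p.1 ω) (U p.2 ω)) ^ 2 ∂P
      = ∑ p ∈ s.offDiag, ∑ q ∈ s.offDiag,
          ∫ ω, G (U p.1 ω) (U p.2 ω) * G (U q.1 ω) (U q.2 ω) ∂P := by
        simp only [sq, Finset.sum_mul_sum]
        rw [integral_finsetSum _ fun p _ => integrable_finsetSum _ fun q _ => hint _ _ _ _]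
        exact Finset.sum_congr rfl fun p _ => integral_finsetSum _ fun q _ => hint _ _ _ _
    _ ≤ ∑ p ∈ s.offDiag, ∑ q ∈ s.offDiag,
          ((if q = p then C ^ 2 else 0) + (if q = p.swap then C ^ 2 else 0)) :=
        Finset.sum_le_sum fun p hp => Finset.sum_le_sum fun q hq => key p hp q hq
    _ ≤ ∑ p ∈ s.offDiag, 2 * C ^ 2 := by
        refine Finset.sum_le_sum fun p hp => ?_
        rw [Finset.sum_add_distrib, Finset.sum_ite_eq', Finset.sum_ite_eq', two_mul]
        gcongr <;> split_ifs <;> first | exact le_rfl | exact sq_nonneg C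
    _ = s.offDiag.card * (2 * C ^ 2) := by rw [Finset.sum_const, nsmul_eq_mul]

end UStatistic

/-! ### Hoeffding decomposition and central limit theorem. -/

namespace UStatistic

lemma sum_offDiag_eq {ι M : Type*} [DecidableEq ι] [AddCommGroup M] (s : Finset ι)
    (f : ι → ι → M) :
    ∑ p ∈ s.offDiag, f p.1 p.2 = ∑ i ∈ s, ∑ j ∈ s, f i j - ∑ i ∈ s, f i i := by
  rw [← Finset.sum_product' s s f, ← Finset.diag_union_offDiag,
    Finset.sum_union (Finset.disjoint_diag_offDiag _), Finset.sum_diag]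
  abel

variable {α Ω : Type*} [MeasurableSpace α] [MeasurableSpace Ω]
  {Q : Measure α} [IsProbabilityMeasure Q] {H : α → α → ℝ}

/-- Hoeffding decomposition of a sum over ordered pairs. -/
lemma sum_offDiag_hoeffding (Q : Measure α) {ι : Type*} [DecidableEq ι] (s : Finset ι) (x : ι → α) :
    ∑ p ∈ s.offDiag, H (x p.1) (x p.2) =
      ∑ p ∈ s.offDiag, degen Q H (x p.1) (x p.2) + 2 * (s.card - 1) * ∑ i ∈ s, proj Q H (x i)
        - s.card * (s.card - 1) * ∫ z, proj Q H z ∂Q := by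
  rw [sum_offDiag_eq s fun i j => H (x i) (x j),
    sum_offDiag_eq s fun i j => degen Q H (x i) (x j)]
  simp only [degen, Finset.sum_add_distrib, Finset.sum_sub_distrib, Finset.sum_const,
    nsmul_eq_mul, ← Finset.mul_sum]
  ring

/-- The covariance of two values of a kernel that share their first argument. -/
lemma covariance_kernel (hH : Measurable (Function.uncurry H)) {C : ℝ}
    (hC : ∀ x y, |H x y| ≤ C) :
    covariance (fun p : α × α × α => H p.1 p.2.1) (fun p : α × α × α => H p.1 p.2.2)
      (Q.prod (Q.prod Q)) = Var[proj Q H; Q] := by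
  have m1 : Measurable fun p : α × α × α => H p.1 p.2.1 :=
    hH.comp (g := Function.uncurry H) (f := fun p : α × α × α => (p.1, p.2.1)) (by fun_prop)
  have m2 : Measurable fun p : α × α × α => H p.1 p.2.2 :=
    hH.comp (g := Function.uncurry H) (f := fun p : α × α × α => (p.1, p.2.2)) (by fun_prop)
  have mp := measurable_proj (Q := Q) hH
  have b1 : ∀ p : α × α × α, |H p.1 p.2.1| ≤ C := fun p => hC _ _
  have b2 : ∀ p : α × α × α, |H p.1 p.2.2| ≤ C := fun p => hC _ _
  have b3 : ∀ p : α × α × α, |H p.1 p.2.1 * H p.1 p.2.2| ≤ C * C := fun p => by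
    rw [abs_mul]
    exact mul_le_mul (b1 p) (b2 p) (abs_nonneg _) ((abs_nonneg _).trans (b1 p))
  rw [covariance_eq_sub (MemLp.of_bound m1.aestronglyMeasurable C (Eventually.of_forall b1))
    (MemLp.of_bound m2.aestronglyMeasurable C (Eventually.of_forall b2)),
    variance_eq_sub (MemLp.of_bound mp.aestronglyMeasurable C
      (Eventually.of_forall (abs_proj_le hC)))]
  have e1 : ∫ p, H p.1 p.2.1 ∂(Q.prod (Q.prod Q)) = ∫ x, proj Q H x ∂Q := by
    rw [integral_prod _ (integrable_of_abs_le m1 b1)]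
    refine integral_congr_ae (Eventually.of_forall fun x => ?_)
    simp only [proj]
    rw [integral_fun_fst (μ := Q) (ν := Q) (H x)]
    simp
  have e2 : ∫ p, H p.1 p.2.2 ∂(Q.prod (Q.prod Q)) = ∫ x, proj Q H x ∂Q := by
    rw [integral_prod _ (integrable_of_abs_le m2 b2)]
    refine integral_congr_ae (Eventually.of_forall fun x => ?_)
    simp only [proj]
    rw [integral_fun_snd (μ := Q) (ν := Q) (H x)]
    simp
  have e3 : ∫ p, H p.1 p.2.1 * H p.1 p.2.2 ∂(Q.prod (Q.prod Q)) = ∫ x, proj Q H x ^ 2 ∂Q := by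
    have i3 : Integrable (fun p : α × α × α => H p.1 p.2.1 * H p.1 p.2.2) (Q.prod (Q.prod Q)) :=
      integrable_of_abs_le (m1.mul m2) b3
    rw [integral_prod _ i3]
    refine integral_congr_ae (Eventually.of_forall fun x => ?_)
    simp only [proj]
    rw [integral_prod_mul (μ := Q) (ν := Q) (H x) (H x), sq]
  simp only [Pi.mul_apply, Pi.pow_apply]
  rw [e1, e2, e3, sq]

variable {P : Measure Ω} [IsProbabilityMeasure P] {U : ℕ → Ω → α}

/-- A U-statistic of order two with a bounded kernel. -/
def uStat (H : α → α → ℝ) (U : ℕ → Ω → α) (n : ℕ) (ω : Ω) : ℝ :=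
  (∑ p ∈ (Finset.range n).offDiag, H (U p.1 ω) (U p.2 ω)) / (n * (n - 1))

lemma measurable_sum_offDiag {ι : Type*} [DecidableEq ι] {U : ι → Ω → α}
    (hH : Measurable (Function.uncurry H)) (hU : ∀ i, Measurable (U i)) (s : Finset ι) :
    Measurable fun ω => ∑ p ∈ s.offDiag, H (U p.1 ω) (U p.2 ω) :=
  Finset.measurable_fun_sum _ fun p _ =>
    hH.comp (g := Function.uncurry H) (f := fun ω => (U p.1 ω, U p.2 ω)) (by fun_prop)

/-- **Hoeffding's central limit theorem** for U-statistics of order two with a bounded kernel. -/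
theorem tendstoInDistribution_uStat (hH : Measurable (Function.uncurry H))
    (hs : ∀ x y, H x y = H y x) {C : ℝ} (hC : ∀ x y, |H x y| ≤ C)
    (hU : ∀ i, Measurable (U i)) (hind : iIndepFun U P) (hlaw : ∀ i, P.map (U i) = Q) :
    TendstoInDistribution (fun (n : ℕ) ω => √n * (uStat H U n ω - ∫ z, proj Q H z ∂Q)) atTop
      (id : ℝ → ℝ) (fun _ => P) (gaussianReal 0 (4 * Var[proj Q H; Q]).toNNReal) := by
  have mp := measurable_proj (Q := Q) hH
  have bp := abs_proj_le (Q := Q) hC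
  set μ := ∫ z, proj Q H z ∂Q with hμ
  -- The factor 2 counts the two arguments of the kernel, each projected once; it becomes the 4 in
  -- the limiting variance.
  set Z : ℕ → Ω → ℝ := fun i ω => 2 * proj Q H (U i ω) with hZ
  have mZ : Measurable fun x => 2 * proj Q H x := mp.const_mul 2
  have hZm : ∀ i, Measurable (Z i) := fun i => mZ.comp (hU i)
  have hident : ∀ i j, IdentDistrib (U i) (U j) P P := fun i j =>
    ⟨(hU i).aemeasurable, (hU j).aemeasurable, by rw [hlaw, hlaw]⟩
  have hvar : Var[Z 0; P] = 4 * Var[proj Q H; Q] := by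
    have : Var[fun ω => proj Q H (U 0 ω); P] = Var[proj Q H; Q] := by
      have h := variance_map (X := proj Q H) (Y := U 0) (μ := P)
        mp.aemeasurable (hU 0).aemeasurable
      rw [hlaw 0] at h
      exact h.symm
    rw [hZ, variance_const_mul, this]; norm_num
  have hmean : P[Z 0] = 2 * μ := by
    simp only [hZ]
    have h := integral_map (μ := P) (f := proj Q H) (hU 0).aemeasurable mp.aestronglyMeasurable
    rw [hlaw 0] at h
    rw [integral_const_mul, hμ, h]
  have clt := tendstoInDistribution_inv_sqrt_mul_sum_sub (P := P) (X := Z)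
    (P' := gaussianReal 0 (4 * Var[proj Q H; Q]).toNNReal) (Y := id)
    (by rw [hvar]; exact HasLaw.id)
    (MemLp.of_bound (hZm 0).aestronglyMeasurable (2 * C) (Eventually.of_forall fun ω => by
      simpa [hZ, abs_mul] using bp (U 0 ω)))
    (hind.comp (fun _ x => 2 * proj Q H x) fun _ => mZ)
    (fun i => (hident i 0).comp mZ)
  -- Slutsky: it remains to see that the normalized U-statistic and the normalized sum of
  -- projections differ by a term tending to 0 in probability.
  refine tendstoInDistribution_of_tendstoInMeasure_sub _ _ clt ?_ fun n =>
    ((((measurable_sum_offDiag hH hU _).div_const _).sub_const _).const_mul _).aemeasurable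
  set D : ℕ → Ω → ℝ := fun n ω => ∑ p ∈ (Finset.range n).offDiag, degen Q H (U p.1 ω) (U p.2 ω)
    with hD
  have mD : ∀ n, Measurable (D n) := fun n => measurable_sum_offDiag (measurable_degen hH) hU _
  have hcard : ∀ n : ℕ, ((Finset.range n).offDiag.card : ℝ) = n * (n - 1) := fun n => by
    rw [Finset.offDiag_card, Finset.card_range, Nat.cast_sub (Nat.le_mul_self n)]
    push_cast; ring
  -- Degeneracy gives order `n²` here instead of the trivial `n⁴`; after multiplication by the
  -- squared factor `n / (n (n - 1))²` the bound is of order `1 / (n - 1)`.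
  have second : ∀ n, ∫ ω, D n ω ^ 2 ∂P ≤ n * (n - 1) * (2 * (4 * C) ^ 2) := fun n => by
    have := integral_sq_sum_offDiag_le (measurable_degen (Q := Q) hH) (degen_symm hs)
      (abs_degen_le hC) (integral_degen hH hC) hU hind hlaw (Finset.range n)
    rwa [hcard] at this
  have hDint : ∀ n, Integrable (fun ω => D n ω ^ 2) P := fun n =>
    integrable_of_abs_le (C := ((Finset.range n).offDiag.card * (4 * C)) ^ 2) ((mD n).pow_const 2)
      fun ω => by
        rw [abs_pow]
        refine pow_le_pow_left₀ (abs_nonneg _) ?_ 2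
        refine (Finset.abs_sum_le_sum_abs _ _).trans ?_
        rw [← nsmul_eq_mul]
        exact Finset.sum_le_card_nsmul _ _ _ fun p _ => abs_degen_le hC _ _
  have hdiff : ∀ n : ℕ, 2 ≤ n → ∀ ω, √n * (uStat H U n ω - μ) -
      (√n)⁻¹ * (∑ k ∈ Finset.range n, Z k ω - n * P[Z 0]) = √n / (n * (n - 1)) * D n ω := by
    intro n hn ω
    have hn' : (2 : ℝ) ≤ n := by exact_mod_cast hn
    have n0 : (n : ℝ) ≠ 0 := by positivity
    have n1 : (n : ℝ) - 1 ≠ 0 := by linarith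
    have hsq : √(n : ℝ) * √(n : ℝ) = n := Real.mul_self_sqrt (by positivity)
    have hinv : (√(n : ℝ))⁻¹ = √n / n := by
      rw [inv_eq_one_div, div_eq_div_iff (by positivity) n0, one_mul, hsq]
    rw [hmean, uStat, sum_offDiag_hoeffding Q _ fun i => U i ω, ← hμ, Finset.card_range, hinv]
    simp only [hZ, ← Finset.mul_sum, hD]
    field_simp
    ring
  rw [tendstoInMeasure_iff_measureReal_norm]
  intro ε hε
  have lim : Tendsto (fun n : ℕ => (2 * (4 * C) ^ 2 / ε ^ 2) * ((n : ℝ) - 1)⁻¹) atTop (𝓝 0) := by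
    have h : Tendsto (fun n : ℕ => ((n : ℝ) - 1)⁻¹) atTop (𝓝 0) :=
      tendsto_inv_atTop_zero.comp
        (tendsto_atTop_add_const_right _ _ tendsto_natCast_atTop_atTop)
    simpa using h.const_mul (2 * (4 * C) ^ 2 / ε ^ 2)
  refine squeeze_zero' (Eventually.of_forall fun n => measureReal_nonneg) ?_ lim
  filter_upwards [eventually_ge_atTop 2] with n hn
  have hn' : (2 : ℝ) ≤ n := by exact_mod_cast hn
  have n1 : (0 : ℝ) < n - 1 := by linarith
  have n0 : (0 : ℝ) < n := by linarith
  set a : ℝ := √n / (n * (n - 1)) with ha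
  have hset : {ω | ε ≤ ‖((fun (n : ℕ) ω => √n * (uStat H U n ω - μ)) -
      fun (n : ℕ) ω => (√n)⁻¹ * (∑ k ∈ Finset.range n, Z k ω - n * P[Z 0])) n ω -
        (0 : Ω → ℝ) ω‖} ⊆ {ω | ε ^ 2 ≤ a ^ 2 * D n ω ^ 2} := by
    intro ω hω
    simp only [Pi.sub_apply, Pi.zero_apply, sub_zero, mem_ofPred_eq, hdiff n hn ω] at hω ⊢
    rw [← mul_pow, ← sq_abs (a * D n ω)]
    exact pow_le_pow_left₀ hε.le hω 2
  refine (measureReal_mono hset).trans ?_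
  -- Chebyshev's inequality, as Markov's inequality for the square.
  have hmk := mul_meas_ge_le_integral_of_nonneg (μ := P) (f := fun ω => a ^ 2 * D n ω ^ 2)
    (Eventually.of_forall fun ω => by positivity) ((hDint n).const_mul _) (ε ^ 2)
  rw [integral_const_mul] at hmk
  have h2 : a ^ 2 * ∫ ω, D n ω ^ 2 ∂P ≤ a ^ 2 * (n * (n - 1) * (2 * (4 * C) ^ 2)) := by
    gcongr
    exact second n
  have h3 : a ^ 2 * (n * (n - 1) * (2 * (4 * C) ^ 2)) = 2 * (4 * C) ^ 2 * ((n : ℝ) - 1)⁻¹ := by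
    rw [ha, div_pow, Real.sq_sqrt n0.le]
    field_simp
  rw [div_mul_eq_mul_div, le_div_iff₀ (by positivity), mul_comm]
  exact hmk.trans (h2.trans h3.le)

end UStatistic

/-! ### Relative density as a U-statistic, and its law given the vertex set. -/

namespace CentralSimilarity

open UStatistic

/-- The digraph on `V` with an arc from `k` to `l` when `x l ∈ N (x k)`. -/
def arcDigraph (N : ℝ → Set ℝ) {V : Type*} (x : V → ℝ) : Digraph V where
  Adj k l := x l ∈ N (x k)

/-- Relative density of the digraph of `x`. -/
def density (N : ℝ → Set ℝ) {V : Type*} (x : V → ℝ) : ℝ := relDensity (arcDigraph N x)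

/-- The vertex set of a component is a random subtype; invariance under relabelling lets it be
replaced by a fixed index type. -/
lemma density_comp_equiv (N : ℝ → Set ℝ) {V W : Type*} (e : V ≃ W) (x : W → ℝ) :
    density N (fun v => x (e v)) = density N x := by
  have h : Nat.card {p : V × V // p.1 ≠ p.2 ∧ x (e p.2) ∈ N (x (e p.1))} =
      Nat.card {p : W × W // p.1 ≠ p.2 ∧ x p.2 ∈ N (x p.1)} :=
    Nat.card_congr ((e.prodCongr e).subtypeEquiv fun p => by simp)
  simp only [density, relDensity, arcDigraph, h, Nat.card_congr e]

lemma arcKernel_symm (N : ℝ → Set ℝ) (x z : ℝ) : arcKernel N x z = arcKernel N z x := by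
  simp only [arcKernel, add_comm]

lemma abs_arcKernel_le (N : ℝ → Set ℝ) (x z : ℝ) : |arcKernel N x z| ≤ 1 := by
  unfold arcKernel; split_ifs <;> norm_num

/-- Swapping the entries permutes the ordered pairs, so both indicators in the kernel have the same
sum, namely the number of arcs; symmetrizing costs nothing. -/
lemma density_eq_sum (N : ℝ → Set ℝ) {V : Type*} [Fintype V] [DecidableEq V] (x : V → ℝ) :
    density N x = (∑ p ∈ (Finset.univ : Finset V).offDiag, arcKernel N (x p.1) (x p.2)) /
      ((Fintype.card V : ℝ) * ((Fintype.card V : ℝ) - 1)) := by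
  classical
  have h1 : (Nat.card {p : V × V // p.1 ≠ p.2 ∧ x p.2 ∈ N (x p.1)} : ℝ) =
      ∑ p ∈ (Finset.univ : Finset V).offDiag, if x p.2 ∈ N (x p.1) then 1 else 0 := by
    rw [Finset.sum_boole, Nat.card_eq_fintype_card, Fintype.card_subtype]
    congr 2
    ext p
    simp
  have h2 : ∑ p ∈ (Finset.univ : Finset V).offDiag, (if x p.1 ∈ N (x p.2) then (1 : ℝ) else 0) =
      ∑ p ∈ (Finset.univ : Finset V).offDiag, if x p.2 ∈ N (x p.1) then 1 else 0 :=
    Finset.sum_nbij' Prod.swap Prod.swap (by simp [eq_comm]) (by simp [eq_comm]) (by simp)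
      (by simp) (by simp)
  simp only [density, relDensity, arcDigraph, arcKernel, Nat.card_eq_fintype_card (α := V)]
  rw [h1, ← Finset.sum_div, Finset.sum_add_distrib, h2]
  ring

variable {N : ℝ → Set ℝ}

lemma measurable_arcKernel (hN : MeasurableSet {p : ℝ × ℝ | p.2 ∈ N p.1}) :
    Measurable (Function.uncurry (arcKernel N)) := by
  classical
  have h1 : Measurable fun p : ℝ × ℝ => if p.2 ∈ N p.1 then (1 : ℝ) else 0 :=
    Measurable.ite hN measurable_const measurable_const
  have h2 : Measurable fun p : ℝ × ℝ => if p.1 ∈ N p.2 then (1 : ℝ) else 0 :=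
    h1.comp measurable_swap
  exact (h1.add h2).div_const 2

lemma measurable_density (hN : MeasurableSet {p : ℝ × ℝ | p.2 ∈ N p.1}) {V : Type*} [Fintype V] :
    Measurable fun x : V → ℝ => density N x := by
  classical
  simp only [density_eq_sum]
  exact (measurable_sum_offDiag (measurable_arcKernel hN) (fun i => measurable_pi_apply i)
    _).div_const _

/-- The U-statistic with the arc kernel, as a function of infinitely many data points. -/
def arcStat (N : ℝ → Set ℝ) (k : ℕ) (x : ℕ → ℝ) : ℝ :=
  uStat (arcKernel N) (fun i (x : ℕ → ℝ) => x i) k x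

lemma measurable_arcStat (hN : MeasurableSet {p : ℝ × ℝ | p.2 ∈ N p.1}) (k : ℕ) :
    Measurable (arcStat N k) :=
  (measurable_sum_offDiag (measurable_arcKernel hN) (fun i => measurable_pi_apply i)
    _).div_const _

lemma density_fin_eq_arcStat (N : ℝ → Set ℝ) (k : ℕ) (x : ℕ → ℝ) :
    density N (fun i : Fin k => x i) = arcStat N k x := by
  rw [density_eq_sum, arcStat, uStat, Fintype.card_fin]
  congr 1
  refine Finset.sum_bij (fun p _ => ((p.1 : ℕ), (p.2 : ℕ))) ?_ ?_ ?_ ?_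
  · simp [Fin.ext_iff]
  · simp [Fin.ext_iff, Prod.ext_iff]
  · rintro ⟨a, b⟩ h
    simp only [Finset.mem_offDiag, Finset.mem_range] at h
    exact ⟨(⟨a, h.1⟩, ⟨b, h.2.1⟩), by simpa [Fin.ext_iff] using h.2.2, rfl⟩
  · simp

variable {Ω : Type*} [MeasurableSpace Ω]

/-- The law of the relative density of a finite family of independent variables of law `Q`. -/
lemma map_density_of_iIndepFun (hN : MeasurableSet {p : ℝ × ℝ | p.2 ∈ N p.1})
    {P : Measure Ω} [IsProbabilityMeasure P] {Q : Measure ℝ} [IsProbabilityMeasure Q]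
    {V : Type*} [Fintype V] {Z : V → Ω → ℝ} (hZ : ∀ v, Measurable (Z v)) (hind : iIndepFun Z P)
    (hlaw : ∀ v, P.map (Z v) = Q) :
    P.map (fun ω => density N fun v => Z v ω) =
      (Measure.infinitePi fun _ : ℕ => Q).map (arcStat N (Fintype.card V)) := by
  set k := Fintype.card V
  let e : V ≃ Fin k := Fintype.equivFin V
  have hf : Function.Injective fun v => (e v : ℕ) := Fin.val_injective.comp e.injective
  have h1 : P.map (fun ω v => Z v ω) = Measure.infinitePi fun _ : V => Q := by
    rw [(iIndepFun_iff_map_fun_eq_infinitePi_map hZ).1 hind]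
    simp [hlaw]
  have h2 : (Measure.infinitePi fun _ : ℕ => Q).map (fun x v => x (e v : ℕ)) =
      Measure.infinitePi fun _ : V => Q :=
    Measure.map_infinitePi_infinitePi_of_inj (P := fun _ : ℕ => Q) hf
  have h3 : arcStat N k = fun x : ℕ → ℝ => density N fun v : V => x (e v : ℕ) := by
    funext x
    rw [← density_fin_eq_arcStat, ← density_comp_equiv N e]
  have hd := measurable_density (V := V) hN
  calc P.map (fun ω => density N fun v => Z v ω)
      = (P.map fun ω v => Z v ω).map (density N) :=
        (Measure.map_map hd (measurable_pi_lambda _ hZ)).symm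
    _ = _ := by
        rw [h1, ← h2, Measure.map_map hd (by fun_prop), h3]
        rfl

/-- Number of the first `n` data points in `C`. -/
def countIn (C : Set ℝ) (X : ℕ → Ω → ℝ) (n : ℕ) (ω : Ω) : ℕ :=
  Nat.card {k : Fin n // X k ω ∈ C}

/-- Relative density of the digraph of those of the first `n` data points that lie in `C`. -/
def densityIn (N : ℝ → Set ℝ) (C : Set ℝ) (X : ℕ → Ω → ℝ) (n : ℕ) (ω : Ω) : ℝ :=
  density N fun v : {k : Fin n // X k ω ∈ C} => X v ω

/-- The event that the data points in `C` are those with index in `S`. -/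
def patternEvent (C : Set ℝ) (X : ℕ → Ω → ℝ) {n : ℕ} (S : Finset (Fin n)) : Set Ω :=
  ⋂ i : Fin n, X i ⁻¹' (if i ∈ S then C else Cᶜ)

variable {C : Set ℝ} {X : ℕ → Ω → ℝ} {n : ℕ} {S : Finset (Fin n)} {ω : Ω}

omit [MeasurableSpace Ω] in
lemma mem_patternEvent : ω ∈ patternEvent C X S ↔ ∀ i : Fin n, X i ω ∈ C ↔ i ∈ S := by
  simp only [patternEvent, mem_iInter, mem_preimage]
  refine forall_congr' fun i => ?_
  by_cases h : i ∈ S <;> simp [h]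

omit [MeasurableSpace Ω] in
lemma countIn_of_mem_patternEvent (h : ω ∈ patternEvent C X S) : countIn C X n ω = S.card := by
  rw [mem_patternEvent] at h
  rw [countIn, Nat.card_congr (Equiv.subtypeEquivRight h)]
  simp

omit [MeasurableSpace Ω] in
lemma densityIn_of_mem_patternEvent (h : ω ∈ patternEvent C X S) :
    densityIn N C X n ω = density N fun v : S => X v ω := by
  rw [mem_patternEvent] at h
  exact density_comp_equiv N (Equiv.subtypeEquivRight h) fun v : S => X v ω

omit [MeasurableSpace Ω] in
lemma exists_mem_patternEvent (C : Set ℝ) (X : ℕ → Ω → ℝ) (n : ℕ) (ω : Ω) :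
    ∃ S : Finset (Fin n), ω ∈ patternEvent C X S := by
  classical
  exact ⟨Finset.univ.filter fun i => X i ω ∈ C, mem_patternEvent.2 fun i => by simp⟩

omit [MeasurableSpace Ω] in
lemma pairwise_disjoint_patternEvent (C : Set ℝ) (X : ℕ → Ω → ℝ) (n : ℕ) :
    Pairwise (Function.onFun Disjoint (patternEvent C X (n := n))) := by
  intro S T hST
  refine disjoint_left.2 fun ω hS hT => hST ?_
  rw [mem_patternEvent] at hS hT
  ext i
  rw [← hS, hT]

-- Splits by the set of indices falling in `C`. Together with `pairwise_disjoint_patternEvent` this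
-- turns conditioning on the count into conditioning on patterns.
omit [MeasurableSpace Ω] in
lemma countIn_eq_inter (B : Set Ω) (k : ℕ) :
    {ω | countIn C X n ω = k} ∩ B =
      ⋃ S ∈ (Finset.univ : Finset (Fin n)).powersetCard k, patternEvent C X S ∩ B := by
  ext ω
  simp only [mem_inter_iff, mem_ofPred_eq, mem_iUnion, Finset.mem_powersetCard,
    Finset.subset_univ, true_and, exists_prop]
  constructor
  · rintro ⟨h, hB⟩
    obtain ⟨S, hS⟩ := exists_mem_patternEvent C X n ω
    exact ⟨S, (countIn_of_mem_patternEvent hS).symm.trans h, hS, hB⟩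
  · rintro ⟨S, hk, hS, hB⟩
    exact ⟨(countIn_of_mem_patternEvent hS).trans hk, hB⟩

lemma measurableSet_patternEvent (hC : MeasurableSet C) (hX : ∀ i, Measurable (X i)) :
    MeasurableSet (patternEvent C X S) :=
  MeasurableSet.iInter fun i => hX i (by split_ifs <;> [exact hC; exact hC.compl])

/-- The type of vertices in `densityIn` varies with `ω`. On a pattern event it can be taken to be
the fixed type `S`, where measurability is plain. -/
lemma measurableSet_patternEvent_inter (hN : MeasurableSet {p : ℝ × ℝ | p.2 ∈ N p.1})
    (hC : MeasurableSet C) (hX : ∀ i, Measurable (X i)) {B : Set ℝ} (hB : MeasurableSet B) :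
    MeasurableSet (patternEvent C X S ∩ densityIn N C X n ⁻¹' B) := by
  have : patternEvent C X S ∩ densityIn N C X n ⁻¹' B =
      patternEvent C X S ∩ (fun ω => density N fun v : S => X v ω) ⁻¹' B := by
    ext ω
    simp only [mem_inter_iff, mem_preimage]
    exact and_congr_right fun h => by rw [densityIn_of_mem_patternEvent h]
  rw [this]
  exact (measurableSet_patternEvent hC hX).inter
    (((measurable_density hN).comp (measurable_pi_lambda _ fun v => hX _)) hB)

lemma measurable_countIn (hC : MeasurableSet C) (hX : ∀ i, Measurable (X i)) (n : ℕ) :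
    Measurable (countIn C X n) := by
  refine measurable_to_countable' fun k => ?_
  have := countIn_eq_inter (C := C) (X := X) (n := n) univ k
  simp only [inter_univ] at this
  change MeasurableSet {ω | countIn C X n ω = k}
  rw [this]
  exact Finset.measurableSet_biUnion _ fun S _ => measurableSet_patternEvent hC hX

lemma measurable_densityIn (hN : MeasurableSet {p : ℝ × ℝ | p.2 ∈ N p.1}) (hC : MeasurableSet C)
    (hX : ∀ i, Measurable (X i)) (n : ℕ) : Measurable (densityIn N C X n) := by
  intro B hB
  have : densityIn N C X n ⁻¹' B =
      ⋃ S : Finset (Fin n), patternEvent C X S ∩ densityIn N C X n ⁻¹' B := by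
    rw [← iUnion_inter, eq_comm, inter_eq_right]
    exact fun ω _ => mem_iUnion.2 (exists_mem_patternEvent C X n ω)
  rw [this]
  exact MeasurableSet.iUnion fun S => measurableSet_patternEvent_inter hN hC hX hB

section Conditional

variable {P : Measure Ω} [IsProbabilityMeasure P] {Q₀ : Measure ℝ} [IsProbabilityMeasure Q₀]

omit [IsProbabilityMeasure P] [IsProbabilityMeasure Q₀] in
lemma measure_patternEvent_ne_zero (hC : MeasurableSet C) (hX : ∀ i, Measurable (X i))
    (hind : iIndepFun X P) (hlaw : ∀ i, P.map (X i) = Q₀) (h1 : Q₀ C ≠ 0) (h2 : Q₀ Cᶜ ≠ 0)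
    (S : Finset (Fin n)) : P (patternEvent C X S) ≠ 0 := by
  have hm : ∀ i : Fin n, MeasurableSet (if i ∈ S then C else Cᶜ) := fun i => by
    split_ifs <;> [exact hC; exact hC.compl]
  have h := (hind.precomp (g := fun i : Fin n => (i : ℕ))
    Fin.val_injective).measure_inter_preimage_eq_mul Finset.univ (sets := fun i => if i ∈ S then C else Cᶜ) fun i _ => hm i
  have h' : patternEvent C X S =
      ⋂ i ∈ (Finset.univ : Finset (Fin n)), X i ⁻¹' (if i ∈ S then C else Cᶜ) := by
    simp [patternEvent]
  rw [h', h, Finset.prod_ne_zero_iff]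
  intro i _
  rw [← Measure.map_apply (hX i) (hm i), hlaw]
  split_ifs <;> assumption

/-- A pattern event constrains each coordinate separately, so conditioning on it keeps the
coordinates independent and gives those with index in `S` the law `Q₀` conditioned on `C`. The
resulting law depends on `S` only through its cardinality. -/
lemma measure_patternEvent_inter (hN : MeasurableSet {p : ℝ × ℝ | p.2 ∈ N p.1})
    (hC : MeasurableSet C) (hX : ∀ i, Measurable (X i)) (hind : iIndepFun X P)
    (hlaw : ∀ i, P.map (X i) = Q₀) (h1 : Q₀ C ≠ 0) (h2 : Q₀ Cᶜ ≠ 0) (S : Finset (Fin n))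
    {B : Set ℝ} (hB : MeasurableSet B) :
    P (patternEvent C X S ∩ densityIn N C X n ⁻¹' B) = P (patternEvent C X S) *
      (Measure.infinitePi fun _ : ℕ => ProbabilityTheory.cond Q₀ C).map (arcStat N S.card) B := by
  have : IsProbabilityMeasure (ProbabilityTheory.cond Q₀ C) := cond_isProbabilityMeasure h1
  have hpos := measure_patternEvent_ne_zero hC hX hind hlaw h1 h2 S
  set P' := ProbabilityTheory.cond P (patternEvent C X S)
  have : IsProbabilityMeasure P' := cond_isProbabilityMeasure hpos
  have hmA := measurableSet_patternEvent (S := S) hC hX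
  set t : Fin n → Set ℝ := fun i => if i ∈ S then C else Cᶜ with ht
  have hm : ∀ i, MeasurableSet (t i) := fun i => by
    simp only [ht]; split_ifs <;> [exact hC; exact hC.compl]
  -- `iIndepFun.cond` conditions one family on events of another and asks for independence of the
  -- joint pairs; here both families are `X`.
  have hind2 : iIndepFun (fun (i : Fin n) ω => (X i ω, X i ω)) P :=
    (hind.precomp (g := fun i : Fin n => (i : ℕ)) Fin.val_injective).comp
      (fun _ x => (x, x)) fun _ => by fun_prop
  have hne : ∀ i : Fin n, P (X i ⁻¹' t i) ≠ 0 := fun i => by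
    rw [← Measure.map_apply (hX i) (hm i), hlaw]
    simp only [ht]; split_ifs <;> assumption
  have hind3 : iIndepFun (fun i : Fin n => X i) P' :=
    iIndepFun.cond (X := fun i : Fin n => X i) (Y := fun i : Fin n => X i) (fun i => hX i)
      hind2 hne hm
  have hlaw3 : ∀ v : S, P'.map (X v) = ProbabilityTheory.cond Q₀ C := by
    intro v
    ext D hD
    have h := cond_iInter (X := fun i : Fin n => X i) (Y := fun i : Fin n => X i) (s := {v.1})
      (f := fun i => X i ⁻¹' D) (t := t) (fun i => hX i) hind2 (fun i _ => ⟨D, hD, rfl⟩)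
      (fun i _ => hne i) hm
    simp only [Finset.mem_singleton, iInter_iInter_eq_left, Finset.prod_singleton] at h
    rw [Measure.map_apply (hX _) hD]
    refine h.trans ?_
    have hv : t v = C := by simp [ht]
    rw [hv, cond_apply (hX _ hC), cond_apply hC, ← hlaw v, Measure.map_apply (hX _) hC,
      Measure.map_apply (hX _) (hC.inter hD)]
    rfl
  have hmap := map_density_of_iIndepFun hN (Z := fun v : S => X v) (fun v => hX v)
    (hind3.precomp Subtype.val_injective) hlaw3
  rw [Fintype.card_coe] at hmap
  have hmd : Measurable fun ω => density N fun v : S => X v ω :=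
    (measurable_density hN).comp (measurable_pi_lambda _ fun v => hX _)
  rw [← hmap, Measure.map_apply hmd hB, mul_comm,
    cond_mul_eq_inter hmA]
  congr 1
  ext ω
  simp only [mem_inter_iff, mem_preimage]
  exact and_congr_right fun h => by rw [densityIn_of_mem_patternEvent h]

/-- Given that `k` of the data points lie in `C`, the relative density has the law of the
U-statistic of `k` independent variables with the conditioned distribution. -/
theorem map_cond_densityIn (hN : MeasurableSet {p : ℝ × ℝ | p.2 ∈ N p.1})
    (hC : MeasurableSet C) (hX : ∀ i, Measurable (X i)) (hind : iIndepFun X P)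
    (hlaw : ∀ i, P.map (X i) = Q₀) (h1 : Q₀ C ≠ 0) (h2 : Q₀ Cᶜ ≠ 0) {k : ℕ} (hk : k ≤ n) :
    (ProbabilityTheory.cond P {ω | countIn C X n ω = k}).map (densityIn N C X n) =
      (Measure.infinitePi fun _ : ℕ => ProbabilityTheory.cond Q₀ C).map (arcStat N k) := by
  have hmE : MeasurableSet {ω | countIn C X n ω = k} :=
    measurable_countIn hC hX n (measurableSet_singleton k)
  have hmul : ∀ B : Set ℝ, MeasurableSet B →
      P ({ω | countIn C X n ω = k} ∩ densityIn N C X n ⁻¹' B) = P {ω | countIn C X n ω = k} *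
        (Measure.infinitePi fun _ : ℕ => ProbabilityTheory.cond Q₀ C).map (arcStat N k) B := by
    intro B hB
    have hu := countIn_eq_inter (C := C) (X := X) (n := n) univ k
    simp only [inter_univ] at hu
    have hd := (pairwise_disjoint_patternEvent C X n).set_pairwise
      ((Finset.univ : Finset (Fin n)).powersetCard k : Set (Finset (Fin n)))
    rw [countIn_eq_inter, hu, measure_biUnion_finset hd fun S _ =>
      measurableSet_patternEvent hC hX, measure_biUnion_finset
      (fun S hS T hT h => (hd hS hT h).mono inter_subset_left inter_subset_left) fun S _ =>
      measurableSet_patternEvent_inter hN hC hX hB, Finset.sum_mul]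
    refine Finset.sum_congr rfl fun S hS => ?_
    rw [measure_patternEvent_inter hN hC hX hind hlaw h1 h2 S hB,
      (Finset.mem_powersetCard.1 hS).2]
  -- Since `k ≤ n`, some pattern has exactly `k` indices, and every pattern has positive
  -- probability.
  have hpos : P {ω | countIn C X n ω = k} ≠ 0 := by
    obtain ⟨S, -, hS⟩ := Finset.exists_subset_card_eq (s := (Finset.univ : Finset (Fin n)))
      (n := k) (by simpa using hk)
    refine fun h0 => measure_patternEvent_ne_zero hC hX hind hlaw h1 h2 S
      (measure_mono_null (fun ω hω => ?_) h0)
    exact (countIn_of_mem_patternEvent hω).trans hS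
  ext B hB
  rw [Measure.map_apply (measurable_densityIn hN hC hX n) hB, cond_apply hmE, hmul B hB,
    ← mul_assoc, ENNReal.inv_mul_cancel hpos (measure_ne_top _ _), one_mul]

end Conditional

end CentralSimilarity

/-! ### Conditional mean, conditional limit and unconditional limit. -/

namespace CentralSimilarity

open UStatistic

variable {N : ℝ → Set ℝ} {Q : Measure ℝ} [IsProbabilityMeasure Q]

lemma integral_arcKernel_prod (hN : MeasurableSet {p : ℝ × ℝ | p.2 ∈ N p.1}) :
    ∫ p, arcKernel N p.1 p.2 ∂(Q.prod Q) = (Q.prod Q).real {p | p.2 ∈ N p.1} := by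
  classical
  have e : (fun p : ℝ × ℝ => arcKernel N p.1 p.2) = fun p =>
      ({p | p.2 ∈ N p.1}.indicator 1 p + {p | p.2 ∈ N p.1}.indicator 1 p.swap) / (2 : ℝ) := by
    funext p
    simp [arcKernel, indicator_apply]
  have i1 : Integrable ({p : ℝ × ℝ | p.2 ∈ N p.1}.indicator (1 : ℝ × ℝ → ℝ)) (Q.prod Q) :=
    (integrable_const (1 : ℝ)).indicator hN
  have i2 : Integrable (fun p : ℝ × ℝ =>
      {p : ℝ × ℝ | p.2 ∈ N p.1}.indicator (1 : ℝ × ℝ → ℝ) p.swap) (Q.prod Q) := i1.swap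
  rw [e, integral_div, integral_add i1 i2,
    integral_prod_swap ({p : ℝ × ℝ | p.2 ∈ N p.1}.indicator (1 : ℝ × ℝ → ℝ)),
    integral_indicator_one hN]
  ring

lemma integral_proj_arcKernel (hN : MeasurableSet {p : ℝ × ℝ | p.2 ∈ N p.1}) :
    ∫ x, proj Q (arcKernel N) x ∂Q = (Q.prod Q).real {p | p.2 ∈ N p.1} := by
  rw [← integral_arcKernel_prod hN]
  exact (integral_prod (Function.uncurry (arcKernel N)) (integrable_of_abs_le
    (measurable_arcKernel hN) fun p => abs_arcKernel_le N p.1 p.2)).symm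

/-- Each ordered pair of distinct coordinates has law `Q.prod Q`, so all `k (k - 1)` terms have the
same mean; `2 ≤ k` keeps the normalization from dividing by zero. -/
lemma integral_arcStat (hN : MeasurableSet {p : ℝ × ℝ | p.2 ∈ N p.1}) {k : ℕ} (hk : 2 ≤ k) :
    ∫ x, arcStat N k x ∂(Measure.infinitePi fun _ : ℕ => Q) =
      (Q.prod Q).real {p | p.2 ∈ N p.1} := by
  have hk' : (2 : ℝ) ≤ k := by exact_mod_cast hk
  have hm := measurable_arcKernel hN
  have hmij : ∀ i j : ℕ, Measurable fun x : ℕ → ℝ => arcKernel N (x i) (x j) := fun i j =>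
    hm.comp (f := fun x : ℕ → ℝ => (x i, x j)) (by fun_prop)
  have hpair : ∀ p ∈ (Finset.range k).offDiag,
      ∫ x, arcKernel N (x p.1) (x p.2) ∂(Measure.infinitePi fun _ : ℕ => Q) =
        (Q.prod Q).real {p | p.2 ∈ N p.1} := by
    intro p hp
    have hne := (Finset.mem_offDiag.1 hp).2.2
    rw [← integral_arcKernel_prod hN,
      ← Measure.infinitePi_map_eval_prod (P := fun _ : ℕ => Q) hne]
    exact (integral_map (f := Function.uncurry (arcKernel N))
      (φ := fun x : ℕ → ℝ => (x p.1, x p.2)) (Measurable.aemeasurable (by fun_prop)) hm.aestronglyMeasurable).symm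
  simp only [arcStat, uStat]
  rw [integral_div, integral_finsetSum _ fun p _ => integrable_of_abs_le (hmij _ _)
    fun x => abs_arcKernel_le N _ _, Finset.sum_congr rfl hpair, Finset.sum_const, nsmul_eq_mul,
    Finset.offDiag_card, Finset.card_range, Nat.cast_sub (Nat.le_mul_self k), Nat.cast_mul]
  have h1 : (k : ℝ) - 1 ≠ 0 := by linarith
  have h0 : (k : ℝ) ≠ 0 := by linarith
  field_simp

/-- Expectation of a bounded continuous function of the normalized arc density of `k` points. -/
def arcExpect (N : ℝ → Set ℝ) (Q : Measure ℝ) (μ : ℝ) (f : ℝ →ᵇ ℝ) (k : ℕ) : ℝ :=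
  ∫ x, f (√k * (arcStat N k x - μ)) ∂(Measure.infinitePi fun _ : ℕ => Q)

/-- Hoeffding's theorem for the coordinates of an infinite product, stated as convergence of a
deterministic sequence so that it can be composed with any `k j → ∞`, or with `nᵢ` along a sample
path. -/
lemma tendsto_arcExpect (hN : MeasurableSet {p : ℝ × ℝ | p.2 ∈ N p.1}) (f : ℝ →ᵇ ℝ) :
    Tendsto (arcExpect N Q ((Q.prod Q).real {p | p.2 ∈ N p.1}) f) atTop
      (𝓝 (∫ t, f t ∂(gaussianReal 0 (4 * Var[proj Q (arcKernel N); Q]).toNNReal))) := by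
  have h := tendstoInDistribution_uStat (P := Measure.infinitePi fun _ : ℕ => Q) (Q := Q)
    (U := fun i x => x i) (measurable_arcKernel hN) (arcKernel_symm N) (abs_arcKernel_le N)
    (fun i => measurable_pi_apply i)
    (iIndepFun_infinitePi (X := fun _ x => x) fun _ => measurable_id)
    (fun i => Measure.infinitePi_map_eval _ i)
  rw [integral_proj_arcKernel hN] at h
  have h2 := ProbabilityMeasure.tendsto_iff_forall_integral_tendsto.1 h.tendsto f
  simp only [ProbabilityMeasure.coe_mk, Measure.map_id] at h2
  refine h2.congr fun n => ?_
  rw [integral_map (h.forall_aemeasurable n) f.continuous.measurable.aestronglyMeasurable]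
  rfl

variable {Ω : Type*} [MeasurableSpace Ω] {P : Measure Ω} [IsProbabilityMeasure P]
  {Q₀ : Measure ℝ} [IsProbabilityMeasure Q₀] {C : Set ℝ} {X : ℕ → Ω → ℝ} {n : ℕ}

/-- Integration of functions of the relative density given the number of vertices. -/
lemma integral_cond_densityIn (hN : MeasurableSet {p : ℝ × ℝ | p.2 ∈ N p.1})
    (hC : MeasurableSet C) (hX : ∀ i, Measurable (X i)) (hind : iIndepFun X P)
    (hlaw : ∀ i, P.map (X i) = Q₀) (h1 : Q₀ C ≠ 0) (h2 : Q₀ Cᶜ ≠ 0) {k : ℕ} (hk : k ≤ n)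
    {F : ℕ → ℝ → ℝ} (hF : ∀ k, Measurable (F k)) :
    ∫ ω, F (countIn C X n ω) (densityIn N C X n ω)
        ∂(ProbabilityTheory.cond P {ω | countIn C X n ω = k}) =
      ∫ x, F k (arcStat N k x) ∂(Measure.infinitePi fun _ : ℕ => ProbabilityTheory.cond Q₀ C) := by
  have hmE : MeasurableSet {ω | countIn C X n ω = k} :=
    measurable_countIn hC hX n (measurableSet_singleton k)
  have hd := measurable_densityIn hN hC hX n
  have : IsProbabilityMeasure (ProbabilityTheory.cond Q₀ C) := cond_isProbabilityMeasure h1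
  calc _ = ∫ ω, F k (densityIn N C X n ω)
        ∂(ProbabilityTheory.cond P {ω | countIn C X n ω = k}) := by
        refine integral_congr_ae ?_
        filter_upwards [ae_cond_mem hmE] with ω hω
        rw [hω]
    _ = ∫ t, F k t ∂((ProbabilityTheory.cond P {ω | countIn C X n ω = k}).map
          (densityIn N C X n)) :=
        (integral_map hd.aemeasurable (hF k).aestronglyMeasurable).symm
    _ = _ := by
        rw [map_cond_densityIn hN hC hX hind hlaw h1 h2 hk,
          integral_map (measurable_arcStat hN k).aemeasurable (hF k).aestronglyMeasurable]

omit [MeasurableSpace Ω] in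
lemma countIn_le (C : Set ℝ) (X : ℕ → Ω → ℝ) (n : ℕ) (ω : Ω) : countIn C X n ω ≤ n := by
  simpa [countIn] using Finite.card_subtype_le fun k : Fin n => X k ω ∈ C

omit [MeasurableSpace Ω] in
lemma countIn_eq_sum (C : Set ℝ) (X : ℕ → Ω → ℝ) (n : ℕ) (ω : Ω) :
    (countIn C X n ω : ℝ) = ∑ i ∈ Finset.range n, C.indicator 1 (X i ω) := by
  classical
  rw [Finset.sum_range fun i => C.indicator (1 : ℝ → ℝ) (X i ω)]
  simp [countIn, indicator_apply, Finset.sum_boole, Fintype.card_subtype]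

omit [IsProbabilityMeasure Q₀] in
/-- The number of data points in a set of positive probability tends to infinity. -/
lemma ae_tendsto_countIn (hC : MeasurableSet C) (hX : ∀ i, Measurable (X i))
    (hind : iIndepFun X P) (hlaw : ∀ i, P.map (X i) = Q₀) (h1 : Q₀ C ≠ 0) :
    ∀ᵐ ω ∂P, Tendsto (fun n => countIn C X n ω) atTop atTop := by
  have hm : Measurable (C.indicator (1 : ℝ → ℝ)) := measurable_one.indicator hC
  have hb : ∀ x, |C.indicator (1 : ℝ → ℝ) x| ≤ 1 := fun x => by
    by_cases h : x ∈ C <;> simp [h]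
  have hs := strong_law_ae_real (μ := P) (fun i ω => C.indicator (1 : ℝ → ℝ) (X i ω))
    (integrable_of_abs_le (hm.comp (hX 0)) fun ω => hb _)
    (fun i j hij => (hind.indepFun hij).comp hm hm)
    (fun i => (⟨(hX i).aemeasurable, (hX 0).aemeasurable, by rw [hlaw, hlaw]⟩ :
      IdentDistrib (X i) (X 0) P P).comp hm)
  have hmean : 0 < ∫ ω, C.indicator (1 : ℝ → ℝ) (X 0 ω) ∂P := by
    have : ∫ ω, C.indicator (1 : ℝ → ℝ) (X 0 ω) ∂P = P.real (X 0 ⁻¹' C) :=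
      integral_indicator_one (hX 0 hC)
    rw [this, measureReal_def, ← Measure.map_apply (hX 0) hC, hlaw]
    refine ENNReal.toReal_pos h1 ?_
    rw [← hlaw 0, Measure.map_apply (hX 0) hC]
    exact measure_ne_top _ _
  filter_upwards [hs] with ω hω
  have h := hω.pos_mul_atTop hmean tendsto_natCast_atTop_atTop
  refine tendsto_natCast_atTop_iff.1 (h.congr' ?_ : Tendsto (fun n => (countIn C X n ω : ℝ)) _ _)
  filter_upwards [eventually_gt_atTop 0] with n hn
  rw [countIn_eq_sum, div_mul_cancel₀ _ (by positivity)]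

/-- Conditional asymptotic normality of the relative density. -/
lemma tendsto_integral_cond_densityIn (hN : MeasurableSet {p : ℝ × ℝ | p.2 ∈ N p.1})
    (hC : MeasurableSet C) (hX : ∀ i, Measurable (X i)) (hind : iIndepFun X P)
    (hlaw : ∀ i, P.map (X i) = Q₀) (h1 : Q₀ C ≠ 0) (h2 : Q₀ Cᶜ ≠ 0)
    (hQ : ProbabilityTheory.cond Q₀ C = Q) {s k : ℕ → ℕ} (hks : ∀ j, k j ≤ s j)
    (hk : Tendsto k atTop atTop) (f : ℝ →ᵇ ℝ) :
    Tendsto (fun j => ∫ ω, f (√(countIn C X (s j) ω : ℝ) *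
        (densityIn N C X (s j) ω - (Q.prod Q).real {p | p.2 ∈ N p.1}))
          ∂(ProbabilityTheory.cond P {ω | countIn C X (s j) ω = k j})) atTop
      (𝓝 (∫ t, f t ∂(gaussianReal 0 (4 * Var[proj Q (arcKernel N); Q]).toNNReal))) := by
  refine ((tendsto_arcExpect hN f).comp hk).congr fun j => ?_
  have := integral_cond_densityIn hN hC hX hind hlaw h1 h2 (hks j)
    (F := fun k t => f (√(k : ℝ) * (t - (Q.prod Q).real {p | p.2 ∈ N p.1})))
    fun k => f.continuous.measurable.comp (by fun_prop)
  rw [hQ] at this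
  exact this.symm

/-- Unconditional asymptotic normality of the relative density. -/
lemma tendstoInDistribution_densityIn (hN : MeasurableSet {p : ℝ × ℝ | p.2 ∈ N p.1})
    (hC : MeasurableSet C) (hX : ∀ i, Measurable (X i)) (hind : iIndepFun X P)
    (hlaw : ∀ i, P.map (X i) = Q₀) (h1 : Q₀ C ≠ 0) (h2 : Q₀ Cᶜ ≠ 0)
    (hQ : ProbabilityTheory.cond Q₀ C = Q) :
    TendstoInDistribution (fun (n : ℕ) ω => √(countIn C X n ω : ℝ) *
        (densityIn N C X n ω - (Q.prod Q).real {p | p.2 ∈ N p.1})) atTop (id : ℝ → ℝ)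
      (fun _ => P) (gaussianReal 0 (4 * Var[proj Q (arcKernel N); Q]).toNNReal) := by
  set μ := (Q.prod Q).real {p | p.2 ∈ N p.1} with hμ
  have hcm := measurable_countIn hC hX
  have hm : ∀ n : ℕ, Measurable fun ω => √(countIn C X n ω : ℝ) * (densityIn N C X n ω - μ) :=
    fun n => ((measurable_from_top (f := fun k : ℕ => √(k : ℝ))).comp (hcm n)).mul
      ((measurable_densityIn hN hC hX n).sub_const _)
  refine ⟨fun n => (hm n).aemeasurable, measurable_id.aemeasurable, ?_⟩
  refine ProbabilityMeasure.tendsto_iff_forall_integral_tendsto.2 fun f => ?_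
  simp only [ProbabilityMeasure.coe_mk, Measure.map_id]
  have hfb : ∀ t, |f t| ≤ ‖f‖ := f.norm_coe_le_norm
  -- The tower property with respect to `nᵢ`, carried out as a finite sum over its values `0, …, n`.
  have key : ∀ n : ℕ, ∫ ω, arcExpect N Q μ f (countIn C X n ω) ∂P =
      ∫ t, f t ∂(P.map fun ω => √(countIn C X n ω : ℝ) * (densityIn N C X n ω - μ)) := by
    intro n
    rw [integral_map (hm n).aemeasurable f.continuous.measurable.aestronglyMeasurable]
    have hE : ∀ k, MeasurableSet {ω | countIn C X n ω = k} := fun k =>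
      hcm n (measurableSet_singleton k)
    have hcover : (⋃ k ∈ Finset.range (n + 1), {ω | countIn C X n ω = k}) = univ := by
      refine eq_univ_of_forall fun ω => ?_
      simpa using Nat.lt_succ_of_le (countIn_le C X n ω)
    have hdis : Set.PairwiseDisjoint (Finset.range (n + 1) : Set ℕ)
        fun k => {ω | countIn C X n ω = k} := fun k _ l _ hkl =>
      disjoint_left.2 fun ω hk hl => hkl (Eq.trans (Eq.symm hk) hl)
    have i1 : Integrable (fun ω => arcExpect N Q μ f (countIn C X n ω)) P :=
      integrable_of_abs_le ((measurable_from_top (f := arcExpect N Q μ f)).comp (hcm n))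
        fun ω => abs_integral_le_of_abs_le fun x => hfb _
    have i2 : Integrable (fun ω => f (√(countIn C X n ω : ℝ) * (densityIn N C X n ω - μ))) P :=
      integrable_of_abs_le (f.continuous.measurable.comp (hm n)) fun ω => hfb _
    rw [← setIntegral_univ, ← hcover, integral_biUnion_finset _ (fun k _ => hE k) hdis
      fun k _ => i1.integrableOn, ← setIntegral_univ, ← hcover, integral_biUnion_finset _
      (fun k _ => hE k) hdis fun k _ => i2.integrableOn]
    refine Finset.sum_congr rfl fun k hk => ?_
    rw [setIntegral_congr_fun (g := fun _ => arcExpect N Q μ f k) (hE k)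
      fun ω (hω : countIn C X n ω = k) => by simp only [hω], setIntegral_const]
    have hc := integral_cond_densityIn hN hC hX hind hlaw h1 h2
      (Nat.lt_succ_iff.1 (Finset.mem_range.1 hk))
      (F := fun k t => f (√(k : ℝ) * (t - μ))) fun k => f.continuous.measurable.comp (by fun_prop)
    rw [hQ, ProbabilityTheory.cond, integral_smul_measure] at hc
    rw [arcExpect, ← hc, smul_eq_mul, smul_eq_mul, ← mul_assoc, ENNReal.toReal_inv,
      measureReal_def]
    -- The conditional measure is meaningless on a null event, but then both contributions vanish.
    by_cases h0 : (P {ω | countIn C X n ω = k}).toReal = 0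
    · have : P {ω | countIn C X n ω = k} = 0 := by
        simpa [ENNReal.toReal_eq_zero_iff] using h0
      rw [Measure.restrict_eq_zero.2 this]
      simp
    · rw [mul_inv_cancel₀ h0, one_mul]
  simp only [← key]
  have hlim : ∀ L, L = ∫ t, f t ∂(gaussianReal 0 (4 * Var[proj Q (arcKernel N); Q]).toNNReal) →
      Tendsto (fun n => ∫ ω, arcExpect N Q μ f (countIn C X n ω) ∂P) atTop (𝓝 L) := by
    intro L hL
    rw [show L = ∫ _, L ∂P by simp]
    refine tendsto_integral_of_dominated_convergence (fun _ => ‖f‖) (fun n =>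
      ((measurable_from_top (f := arcExpect N Q μ f)).comp (hcm n)).aestronglyMeasurable)
      (integrable_const _) (fun n => Eventually.of_forall fun ω =>
        abs_integral_le_of_abs_le fun x => hfb _) ?_
    filter_upwards [ae_tendsto_countIn hC hX hind hlaw h1] with ω hω
    rw [hL]
    exact (tendsto_arcExpect hN f).comp hω
  exact hlim _ rfl

end CentralSimilarity

/-! ### Reduction of every cell to the unit interval. -/

namespace CentralSimilarity

open UStatistic

/-! ### Uniform distributions -/

lemma isProbabilityMeasure_unif {a b : ℝ} (hab : a < b) : IsProbabilityMeasure (unif a b) :=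
  cond_isProbabilityMeasure_of_finite (by simpa using hab) (by simp)

instance : IsProbabilityMeasure (unif 0 1) := isProbabilityMeasure_unif one_pos

lemma unif_apply {a b : ℝ} (s : Set ℝ) :
    unif a b s = (ENNReal.ofReal (b - a))⁻¹ * volume (Ioo a b ∩ s) := by
  rw [unif, cond_apply measurableSet_Ioo, Real.volume_Ioo]

/-- Only `|m|` enters the scaling of Lebesgue measure, so orientation-preserving maps and
reflections are handled together. -/
lemma map_unif_affine {a b d m : ℝ} (hab : a < b) (hm : |m| = b - a)
    (hpre : (fun t => d + m * t) ⁻¹' Ioo a b = Ioo 0 1) :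
    (unif 0 1).map (fun t => d + m * t) = unif a b := by
  have hm0 : m ≠ 0 := by
    rintro rfl
    simp at hm
    linarith
  have hφ : Measurable fun t : ℝ => d + m * t := by fun_prop
  ext s hs
  rw [Measure.map_apply hφ hs, unif_apply, unif_apply, ← hpre, ← preimage_inter]
  have : (fun t => d + m * t) ⁻¹' (Ioo a b ∩ s) =
      (m * ·) ⁻¹' ((d + ·) ⁻¹' (Ioo a b ∩ s)) := rfl
  rw [this, Real.volume_preimage_mul_left hm0, measure_preimage_add, abs_inv, hm,
    ENNReal.ofReal_inv_of_pos (by linarith)]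
  simp

lemma cond_unif {a b a' b' : ℝ} (ha : a ≤ a') (hb : b' ≤ b) :
    ProbabilityTheory.cond (unif a b) (Ioo a' b') = unif a' b' := by
  rw [unif, cond_cond_eq_cond_inter' measurableSet_Ioo measurableSet_Ioo (by simp),
    inter_eq_self_of_subset_right (Ioo_subset_Ioo ha hb), unif]

lemma unif_Ioo_ne_zero {a b a' b' : ℝ} (ha : a ≤ a') (hb : b' ≤ b) (h : a' < b') :
    unif a b (Ioo a' b') ≠ 0 := by
  rw [unif_apply, inter_eq_self_of_subset_right (Ioo_subset_Ioo ha hb)]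
  simp [h]

/-- An endpoint strictly inside `(a, b)` leaves an interval of positive mass outside. Every cell has
such an endpoint, a point of `Y`. -/
lemma unif_compl_Ioo_ne_zero {a b a' b' : ℝ} (h : a < a' ∧ a' < b ∨ a < b' ∧ b' < b) :
    unif a b (Ioo a' b')ᶜ ≠ 0 := by
  have hpos : ∀ p q, a ≤ p → q ≤ b → p < q → Ioo p q ⊆ (Ioo a' b')ᶜ →
      unif a b (Ioo a' b')ᶜ ≠ 0 := fun p q hp hq hpq hs h0 =>
    unif_Ioo_ne_zero hp hq hpq (measure_mono_null hs h0)
  rcases h with ⟨h1, h2⟩ | ⟨h1, h2⟩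
  · exact hpos a a' le_rfl h2.le h1 fun x hx hx' => absurd hx.2 (not_lt.2 hx'.1.le)
  · exact hpos b' b h1.le le_rfl h2 fun x hx hx' => absurd hx.1 (not_lt.2 hx'.2.le)

/-! ### Arc probability and covariance through the projection of the arc kernel -/

variable {N N' : ℝ → Set ℝ}

lemma arcProb_eq_integral_proj (hN : MeasurableSet {p : ℝ × ℝ | p.2 ∈ N p.1}) {a b : ℝ}
    (hab : a < b) : arcProb N a b = ∫ x, proj (unif a b) (arcKernel N) x ∂(unif a b) := by
  have := isProbabilityMeasure_unif hab
  rw [integral_proj_arcKernel hN, arcProb]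

lemma arcCov_eq_variance_proj (hN : MeasurableSet {p : ℝ × ℝ | p.2 ∈ N p.1}) {a b : ℝ}
    (hab : a < b) : arcCov N a b = Var[proj (unif a b) (arcKernel N); unif a b] := by
  have := isProbabilityMeasure_unif hab
  rw [arcCov, covariance_kernel (measurable_arcKernel hN) (abs_arcKernel_le N)]

lemma ae_unif_mem : ∀ᵐ x ∂(unif 0 1), x ∈ Ioo (0 : ℝ) 1 := ae_cond_mem measurableSet_Ioo

/-- A change of variables in the inner integral. The equality is only almost everywhere because the
regions need correspond only on `(0, 1)`. -/
lemma proj_arcKernel_transport (hN : MeasurableSet {p : ℝ × ℝ | p.2 ∈ N p.1})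
    {a b : ℝ} {φ : ℝ → ℝ} (hφ : Measurable φ)
    (hmap : (unif 0 1).map φ = unif a b)
    (hiff : ∀ s ∈ Ioo (0 : ℝ) 1, ∀ t ∈ Ioo (0 : ℝ) 1, φ t ∈ N (φ s) ↔ t ∈ N' s) :
    ∀ᵐ s ∂(unif 0 1), proj (unif a b) (arcKernel N) (φ s) = proj (unif 0 1) (arcKernel N') s := by
  filter_upwards [ae_unif_mem] with s hs
  rw [proj, ← hmap, integral_map hφ.aemeasurable
    (measurable_arcKernel hN).of_uncurry_left.aestronglyMeasurable]
  refine integral_congr_ae ?_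
  filter_upwards [ae_unif_mem] with t ht
  classical
  exact congrArg₂ (fun u v : ℝ => (u + v) / 2) (if_congr (hiff s hs t ht) rfl rfl)
    (if_congr (hiff t ht s hs) rfl rfl)

lemma arcProb_transport (hN : MeasurableSet {p : ℝ × ℝ | p.2 ∈ N p.1})
    (hN' : MeasurableSet {p : ℝ × ℝ | p.2 ∈ N' p.1}) {a b : ℝ} (hab : a < b) {φ : ℝ → ℝ}
    (hφ : Measurable φ) (hmap : (unif 0 1).map φ = unif a b)
    (hiff : ∀ s ∈ Ioo (0 : ℝ) 1, ∀ t ∈ Ioo (0 : ℝ) 1, φ t ∈ N (φ s) ↔ t ∈ N' s) :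
    arcProb N a b = arcProb N' 0 1 := by
  have := isProbabilityMeasure_unif hab
  rw [arcProb_eq_integral_proj hN hab, arcProb_eq_integral_proj hN' one_pos]
  have h := integral_map (μ := unif 0 1) (f := proj (unif a b) (arcKernel N)) hφ.aemeasurable
    (measurable_proj (measurable_arcKernel hN)).aestronglyMeasurable
  rw [hmap] at h
  rw [h]
  exact integral_congr_ae (proj_arcKernel_transport hN hφ hmap hiff)

lemma arcCov_transport (hN : MeasurableSet {p : ℝ × ℝ | p.2 ∈ N p.1})
    (hN' : MeasurableSet {p : ℝ × ℝ | p.2 ∈ N' p.1}) {a b : ℝ} (hab : a < b) {φ : ℝ → ℝ}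
    (hφ : Measurable φ) (hmap : (unif 0 1).map φ = unif a b)
    (hiff : ∀ s ∈ Ioo (0 : ℝ) 1, ∀ t ∈ Ioo (0 : ℝ) 1, φ t ∈ N (φ s) ↔ t ∈ N' s) :
    arcCov N a b = arcCov N' 0 1 := by
  have := isProbabilityMeasure_unif hab
  rw [arcCov_eq_variance_proj hN hab, arcCov_eq_variance_proj hN' one_pos]
  have h := variance_map (X := proj (unif a b) (arcKernel N)) (Y := φ) (μ := unif 0 1)
    (measurable_proj (measurable_arcKernel hN)).aemeasurable hφ.aemeasurable
  rw [hmap] at h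
  rw [h]
  exact variance_congr (proj_arcKernel_transport hN hφ hmap hiff)

/-! ### Measurability and affine invariance of the proximity regions -/

lemma measurableSet_midRegion (a b τ c : ℝ) :
    MeasurableSet {p : ℝ × ℝ | p.2 ∈ midRegion a b τ c p.1} := by
  have e : {p : ℝ × ℝ | p.2 ∈ midRegion a b τ c p.1} =
      {p | p.1 ≤ a + c * (b - a)}.ite
        ({p | p.1 - τ * (p.1 - a) < p.2} ∩ {p | p.2 < p.1 + τ * (1 - c) * (p.1 - a) / c})
        ({p | p.1 - c * τ * (b - p.1) / (1 - c) < p.2} ∩ {p | p.2 < p.1 + τ * (b - p.1)})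
      ∩ {p | p.2 ∈ Ioo a b} := by
    ext p
    simp only [midRegion, Set.ite, mem_inter_iff, mem_union, Set.mem_sdiff, mem_ofPred_eq]
    split_ifs with h <;> simp [h, and_assoc]
  rw [e]
  refine MeasurableSet.inter (MeasurableSet.ite ?_ (MeasurableSet.inter ?_ ?_)
    (MeasurableSet.inter ?_ ?_)) (measurable_snd measurableSet_Ioo)
  · exact measurableSet_le (by fun_prop) (by fun_prop)
  all_goals exact measurableSet_lt (by fun_prop) (by fun_prop)

lemma measurableSet_leftEndRegion (b τ : ℝ) :
    MeasurableSet {p : ℝ × ℝ | p.2 ∈ leftEndRegion b τ p.1} :=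
  ((measurableSet_lt (f := fun p : ℝ × ℝ => p.1 - τ * (b - p.1)) (by fun_prop)
    measurable_snd).inter (measurableSet_lt (g := fun p : ℝ × ℝ => p.1 + τ * (b - p.1))
      measurable_snd (by fun_prop))).inter (measurable_snd measurableSet_Iio)

lemma measurableSet_rightEndRegion (a τ : ℝ) :
    MeasurableSet {p : ℝ × ℝ | p.2 ∈ rightEndRegion a τ p.1} :=
  ((measurableSet_lt (f := fun p : ℝ × ℝ => p.1 - τ * (p.1 - a)) (by fun_prop)
    measurable_snd).inter (measurableSet_lt (g := fun p : ℝ × ℝ => p.1 + τ * (p.1 - a))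
      measurable_snd (by fun_prop))).inter (measurable_snd measurableSet_Ioi)

lemma map_unif_increasing {a b : ℝ} (hab : a < b) :
    (unif 0 1).map (fun t => a + (b - a) * t) = unif a b := by
  have h : 0 < b - a := sub_pos.2 hab
  refine map_unif_affine hab (abs_of_pos h) ?_
  ext t
  simp only [mem_preimage, mem_Ioo]
  constructor <;> rintro ⟨h1, h2⟩ <;> constructor <;> nlinarith

lemma map_unif_decreasing {a b : ℝ} (hab : a < b) :
    (unif 0 1).map (fun t => b + -(b - a) * t) = unif a b := by
  have h : 0 < b - a := sub_pos.2 hab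
  refine map_unif_affine hab (by rw [abs_neg, abs_of_pos h]) ?_
  ext t
  simp only [mem_preimage, mem_Ioo]
  constructor <;> rintro ⟨h1, h2⟩ <;> constructor <;> nlinarith

lemma mem_midRegion_affine {a b : ℝ} (hab : a < b) (τ c s t : ℝ) :
    a + (b - a) * t ∈ midRegion a b τ c (a + (b - a) * s) ↔ t ∈ midRegion 0 1 τ c s := by
  have h : 0 < b - a := sub_pos.2 hab
  have e0 : a + (b - a) * s ≤ a + c * (b - a) ↔ s ≤ 0 + c * (1 - 0) := by
    rw [add_le_add_iff_left, mul_comm c, mul_le_mul_iff_right₀ h]; simp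
  have key : ∀ p q P' Q' : ℝ, p = a + (b - a) * P' → q = a + (b - a) * Q' →
      (a + (b - a) * t ∈ Ioo p q ∩ Ioo a b ↔ t ∈ Ioo P' Q' ∩ Ioo 0 1) := by
    rintro p q P' Q' rfl rfl
    simp only [mem_inter_iff, mem_Ioo, add_lt_add_iff_left, mul_lt_mul_iff_right₀ h]
    have e1 : a < a + (b - a) * t ↔ 0 < t := by
      rw [lt_add_iff_pos_right, mul_pos_iff_of_pos_left h]
    have e2 : a + (b - a) * t < b ↔ t < 1 := by
      rw [← lt_sub_iff_add_lt', mul_lt_iff_lt_one_right h]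
    rw [e1, e2]
  unfold midRegion
  by_cases hs : s ≤ 0 + c * (1 - 0)
  · rw [if_pos hs, if_pos (e0.2 hs)]
    exact key _ _ _ _ (by ring) (by ring)
  · rw [if_neg hs, if_neg (mt e0.1 hs)]
    exact key _ _ _ _ (by ring) (by ring)

lemma mem_rightEndRegion_affine {a b : ℝ} (hab : a < b) (τ s t : ℝ) :
    a + (b - a) * t ∈ rightEndRegion a τ (a + (b - a) * s) ↔ t ∈ rightEndRegion 0 τ s := by
  have h : 0 < b - a := sub_pos.2 hab
  have e1 : a < a + (b - a) * t ↔ 0 < t := by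
    rw [lt_add_iff_pos_right, mul_pos_iff_of_pos_left h]
  have e2 : a + (b - a) * s - τ * (a + (b - a) * s - a) = a + (b - a) * (s - τ * (s - 0)) := by
    ring
  have e3 : a + (b - a) * s + τ * (a + (b - a) * s - a) = a + (b - a) * (s + τ * (s - 0)) := by
    ring
  simp only [rightEndRegion, mem_inter_iff, mem_Ioo, mem_Ioi, e1, e2, e3, add_lt_add_iff_left,
    mul_lt_mul_iff_right₀ h]

/-- The reflection exchanges the two bounds of the symmetric interval, so the left end needs no
constants of its own. -/
lemma mem_leftEndRegion_affine {a b : ℝ} (hab : a < b) (τ s t : ℝ) :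
    b + -(b - a) * t ∈ leftEndRegion b τ (b + -(b - a) * s) ↔ t ∈ rightEndRegion 0 τ s := by
  have h : 0 < b - a := sub_pos.2 hab
  have e1 : b + -(b - a) * t < b ↔ 0 < t := by
    rw [add_lt_iff_neg_left, neg_mul, neg_lt_zero, mul_pos_iff_of_pos_left h]
  have e2 : b + -(b - a) * s - τ * (b - (b + -(b - a) * s)) < b + -(b - a) * t ↔
      t < s + τ * (s - 0) := by
    refine ⟨fun h' => lt_of_mul_lt_mul_left (a := b - a) (by linarith) h.le, fun h' => ?_⟩
    have := mul_lt_mul_of_pos_left h' h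
    linarith
  have e3 : b + -(b - a) * t < b + -(b - a) * s + τ * (b - (b + -(b - a) * s)) ↔
      s - τ * (s - 0) < t := by
    refine ⟨fun h' => lt_of_mul_lt_mul_left (a := b - a) (by linarith) h.le, fun h' => ?_⟩
    have := mul_lt_mul_of_pos_left h' h
    linarith
  simp only [leftEndRegion, rightEndRegion, mem_inter_iff, mem_Ioo, mem_Iio, mem_Ioi, e1, e2, e3,
    and_comm]

end CentralSimilarity

/-! ### Positivity of the arc covariances. -/

namespace CentralSimilarity

open UStatistic

lemma unif_real_le {S : Set ℝ} {p q : ℝ} (hpq : p ≤ q)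
    (h : ∀ u ∈ Ioo (0 : ℝ) 1, u ∈ S → u ∈ Icc p q) :
    (unif 0 1).real S ≤ q - p := by
  have : unif 0 1 S ≤ ENNReal.ofReal (q - p) := by
    rw [unif_apply, ← Real.volume_Icc]
    simpa using measure_mono (μ := volume) fun u (hu : u ∈ Ioo (0 : ℝ) 1 ∩ S) => h u hu.1 hu.2
  exact ENNReal.toReal_le_of_le_ofReal (sub_nonneg.2 hpq) this

lemma le_unif_real {S : Set ℝ} {p q : ℝ} (hp : 0 ≤ p) (hq : q ≤ 1) (h : Ioo p q ⊆ S) :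
    q - p ≤ (unif 0 1).real S := by
  rcases le_total q p with hqp | hpq
  · exact (sub_nonpos.2 hqp).trans measureReal_nonneg
  · have h1 : (unif 0 1).real (Ioo p q) = q - p := by
      rw [measureReal_def, unif_apply, inter_eq_self_of_subset_right (Ioo_subset_Ioo hp hq)]
      simp [hpq]
    rw [← h1]
    exact measureReal_mono h

variable {N : ℝ → Set ℝ}

lemma proj_arcKernel_eq (hN : MeasurableSet {p : ℝ × ℝ | p.2 ∈ N p.1}) (x : ℝ) :
    proj (unif 0 1) (arcKernel N) x =
      ((unif 0 1).real (N x) + (unif 0 1).real {u | x ∈ N u}) / 2 := by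
  classical
  have m1 : MeasurableSet (N x) := hN.preimage (f := fun u : ℝ => (x, u)) (by fun_prop)
  have m2 : MeasurableSet {u | x ∈ N u} := hN.preimage (f := fun u : ℝ => (u, x)) (by fun_prop)
  have e : arcKernel N x = fun u =>
      ((N x).indicator 1 u + {u | x ∈ N u}.indicator 1 u) / (2 : ℝ) := by
    funext u
    simp [arcKernel, indicator_apply]
  have i1 : Integrable ((N x).indicator (1 : ℝ → ℝ)) (unif 0 1) :=
    (integrable_const (1 : ℝ)).indicator m1
  have i2 : Integrable ({u | x ∈ N u}.indicator (1 : ℝ → ℝ)) (unif 0 1) :=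
    (integrable_const (1 : ℝ)).indicator m2
  rw [proj, e, integral_div, integral_add i1 i2, integral_indicator_one m1,
    integral_indicator_one m2]

/-- The arc covariance is positive as soon as the projection of the arc kernel is not constant. -/
lemma arcCov_pos_of_proj (hN : MeasurableSet {p : ℝ × ℝ | p.2 ∈ N p.1}) {p q p' q' α β : ℝ}
    (hp : 0 ≤ p) (hpq : p < q) (hq : q ≤ 1) (hp' : 0 ≤ p') (hpq' : p' < q') (hq' : q' ≤ 1)
    (hαβ : α < β) (hα : ∀ x ∈ Ioo p q, proj (unif 0 1) (arcKernel N) x ≤ α)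
    (hβ : ∀ x ∈ Ioo p' q', β ≤ proj (unif 0 1) (arcKernel N) x) : 0 < arcCov N 0 1 := by
  rw [arcCov_eq_variance_proj hN one_pos]
  refine lt_of_le_of_ne (variance_nonneg _ _) fun h0 => ?_
  have hae := ae_eq_integral_of_variance_eq_zero (MemLp.of_bound
    (measurable_proj (Q := unif 0 1) (measurable_arcKernel hN)).aestronglyMeasurable 1
    (Eventually.of_forall (abs_proj_le (Q := unif 0 1) (abs_arcKernel_le N)))) h0.symm
  -- Zero variance would make the projection almost everywhere equal to its mean, so it would take
  -- that value somewhere in each interval of positive length.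
  have hex : ∀ r s : ℝ, 0 ≤ r → r < s → s ≤ 1 → ∃ x ∈ Ioo r s,
      proj (unif 0 1) (arcKernel N) x =
        ∫ y, proj (unif 0 1) (arcKernel N) y ∂(unif 0 1) := by
    intro r s hr hrs hs
    by_contra! hcon
    refine unif_Ioo_ne_zero hr hs hrs (measure_mono_null (fun x hx => ?_) hae)
    exact hcon x hx
  obtain ⟨x, hx, hx'⟩ := hex p q hp hpq hq
  obtain ⟨y, hy, hy'⟩ := hex p' q' hp' hpq' hq'
  have h1 := hα x hx
  have h2 := hβ y hy
  linarith

/-- Criterion for a positive arc covariance in terms of the probabilities of out-arcs and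
in-arcs. -/
lemma arcCov_pos (hN : MeasurableSet {p : ℝ × ℝ | p.2 ∈ N p.1}) {p q p' q' α β : ℝ}
    (hp : 0 ≤ p) (hpq : p < q) (hq : q ≤ 1) (hp' : 0 ≤ p') (hpq' : p' < q') (hq' : q' ≤ 1)
    (hαβ : α < β)
    (hα : ∀ x ∈ Ioo p q, (unif 0 1).real (N x) + (unif 0 1).real {u | x ∈ N u} ≤ α)
    (hβ : ∀ x ∈ Ioo p' q', β ≤ (unif 0 1).real (N x) + (unif 0 1).real {u | x ∈ N u}) :
    0 < arcCov N 0 1 := by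
  refine arcCov_pos_of_proj hN hp hpq hq hp' hpq' hq' (α := α / 2) (β := β / 2) (by linarith)
    (fun x hx => ?_) fun x hx => ?_
  · rw [proj_arcKernel_eq hN]; linarith [hα x hx]
  · rw [proj_arcKernel_eq hN]; linarith [hβ x hx]

/-- For `τ < 1` a point near 0 has few out-arcs and few in-arcs, whereas a point of `(1/4, 1/2)` has
out-probability at least `τ / 4`. For `τ ≥ 1` a point near 0 may be reached from everywhere but has
few out-arcs, so the sum is at most `5/4`; a point near 1 reaches everything and is reached from `(1
/ (1 + τ), 1)`, so the sum is at least `3/2`. -/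
lemma nuEnd_pos {τ : ℝ} (hτ : 0 < τ) : 0 < nuEnd τ := by
  have hN := measurableSet_rightEndRegion 0 τ
  have hout : ∀ x, 0 < x → (unif 0 1).real (rightEndRegion 0 τ x) ≤ x * (1 + τ) := fun x hx => by
    have := unif_real_le (S := rightEndRegion 0 τ x) (p := 0) (q := x * (1 + τ)) (by positivity)
      fun u hu hu' => ⟨hu.1.le, by
        have := hu'.1.2
        linarith⟩
    simpa using this
  rcases lt_or_ge τ 1 with h1 | h1
  · have h1' : 0 < 1 - τ := by linarith
    -- `x * K` adds the bounds `x (1 + τ)` for out-arcs and `x / (1 - τ)` for in-arcs.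
    set K : ℝ := 1 + τ + 1 / (1 - τ) with hK
    have hKpos : 1 < K := by
      have : 0 < 1 / (1 - τ) := by positivity
      linarith
    have hε : 0 < τ / (8 * K) := by positivity
    refine arcCov_pos hN (p := 0) (q := τ / (8 * K)) (p' := 1 / 4) (q' := 1 / 2) (α := τ / 8)
      (β := τ / 4) le_rfl hε ?_ (by norm_num) (by norm_num) (by norm_num) (by linarith) ?_ ?_
    · rw [div_le_one (by positivity)]
      linarith
    · rintro x ⟨hx0, hx1⟩
      have hin : (unif 0 1).real {u | x ∈ rightEndRegion 0 τ u} ≤ x / (1 - τ) := by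
        have := unif_real_le (S := {u | x ∈ rightEndRegion 0 τ u}) (p := 0) (q := x / (1 - τ))
          (by positivity) fun u hu hu' => ⟨hu.1.le, by
            have := hu'.1.1
            rw [le_div_iff₀ h1']
            linarith⟩
        simpa using this
      have h2 := hout x hx0
      have h3 : x * K ≤ τ / 8 := by
        rw [lt_div_iff₀ (by positivity)] at hx1
        linarith
      have h4 : x * K = x * (1 + τ) + x / (1 - τ) := by rw [hK]; ring
      linarith
    · rintro x ⟨hx0, hx1⟩
      have h2 := le_unif_real (S := rightEndRegion 0 τ x) (p := x) (q := x + τ * x)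
        (by linarith) (by nlinarith) fun u hu => ⟨⟨by
          have := hu.1
          have : 0 < τ * x := mul_pos hτ (by linarith)
          linarith, by linarith [hu.2]⟩, by
          have := hu.1
          rw [mem_Ioi]; linarith⟩
      have h3 : (0 : ℝ) ≤ (unif 0 1).real {u | x ∈ rightEndRegion 0 τ u} := measureReal_nonneg
      nlinarith
  · have hτ1 : 0 < 1 + τ := by linarith
    have hlt : 1 / (1 + τ) ≤ 1 / 2 := one_div_le_one_div_of_le (by norm_num) (by linarith)
    refine arcCov_pos hN (p := 0) (q := 1 / (4 * (1 + τ))) (p' := 1 / (1 + τ)) (q' := 1)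
      (α := 5 / 4) (β := 3 / 2) le_rfl (by positivity) ?_ (by positivity) (by linarith) le_rfl
      (by norm_num) ?_ ?_
    · rw [div_le_one (by positivity)]
      linarith
    · rintro x ⟨hx0, hx1⟩
      have h2 := hout x hx0
      have h3 : (unif 0 1).real {u | x ∈ rightEndRegion 0 τ u} ≤ 1 := measureReal_le_one
      rw [lt_div_iff₀ (by positivity)] at hx1
      linarith
    · rintro x ⟨hx0, hx1⟩
      have hx : 0 < x := lt_trans (by positivity) hx0
      have hx0' : 1 < x * (1 + τ) := (div_lt_iff₀ hτ1).1 hx0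
      have h2 := le_unif_real (S := rightEndRegion 0 τ x) (p := 0) (q := 1) le_rfl le_rfl
        fun u hu => ⟨⟨by nlinarith [hu.1], by linarith [hu.2]⟩, hu.1⟩
      have h3 := le_unif_real (S := {u | x ∈ rightEndRegion 0 τ u}) (p := 1 / (1 + τ)) (q := 1)
        (by positivity) le_rfl fun u hu => by
          have h4 : 1 < u * (1 + τ) := (div_lt_iff₀ hτ1).1 hu.1
          have h5 : 0 < u := lt_trans (by positivity) hu.1
          exact ⟨⟨by nlinarith, by linarith⟩, hx⟩
      linarith

lemma midRegion_of_le {τ c x : ℝ} (h : x ≤ c) :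
    midRegion 0 1 τ c x = Ioo (x - τ * x) (x + τ * (1 - c) * x / c) ∩ Ioo 0 1 := by
  simp [midRegion, h]

lemma midRegion_of_gt {τ c x : ℝ} (h : c < x) :
    midRegion 0 1 τ c x = Ioo (x - c * τ * (1 - x) / (1 - c)) (x + τ * (1 - x)) ∩ Ioo 0 1 := by
  simp [midRegion, h]

/-- Points near 0 are compared with points just below `c`. For `τ < 1` the former have arc
probabilities of order `x`, the latter out-probability at least `τ * c / 2`. For `τ ≥ 1` many points
reach a neighbourhood of 0, but those in a right-hand piece of length about `θ` do not, while a
point close to `c` reaches nearly all of `(0, 1)`. -/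
lemma nu_pos {τ c : ℝ} (hτ : 0 < τ) (hc : 0 < c) (hc' : c < 1) : 0 < nu τ c := by
  have hN := measurableSet_midRegion 0 1 τ c
  have hd : 0 < 1 - c := by linarith
  set K : ℝ := 1 + τ * (1 - c) / c with hK
  have hKpos : 1 < K := by
    have : 0 < τ * (1 - c) / c := by positivity
    linarith
  have hout : ∀ x, 0 < x → x ≤ c → (unif 0 1).real (midRegion 0 1 τ c x) ≤ x * K :=
    fun x hx hxc => by
      rw [midRegion_of_le hxc]
      have := unif_real_le (S := Ioo (x - τ * x) (x + τ * (1 - c) * x / c) ∩ Ioo 0 1) (p := 0)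
        (q := x * K) (by positivity) fun u hu hu' => ⟨hu.1.le, by
          have h := hu'.1.2.le
          have e : x * K = x + τ * (1 - c) * x / c := by rw [hK]; ring
          rwa [e]⟩
      simpa using this
  rcases lt_or_ge τ 1 with h1 | h1
  · have h1' : 0 < 1 - τ := by linarith
    set L : ℝ := K + 1 / (1 - τ) with hL
    have hLpos : 1 < L := by
      have : 0 < 1 / (1 - τ) := by positivity
      linarith
    -- Below `c * (1 - τ)` no point is reached from beyond `c`; the second bound makes the total `x
    -- * L` at most `τ * c / 4`.
    set ε : ℝ := min (c * (1 - τ)) (τ * c / (4 * L)) with hε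
    have hε0 : 0 < ε := lt_min (by positivity) (by positivity)
    have hε1 : ε ≤ c * (1 - τ) := min_le_left _ _
    have hε2 : ε ≤ τ * c / (4 * L) := min_le_right _ _
    have hcτ : c * (1 - τ) ≤ c := by nlinarith
    refine arcCov_pos hN (p := 0) (q := ε) (p' := c / 2) (q' := c) (α := τ * c / 4)
      (β := τ * c / 2) le_rfl hε0 (by linarith) (by linarith) (by linarith) hc'.le
      (by nlinarith) ?_ ?_
    · rintro x ⟨hx0, hx1⟩
      have hxc : x ≤ c := by linarith
      have hin : (unif 0 1).real {u | x ∈ midRegion 0 1 τ c u} ≤ x / (1 - τ) := by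
        have := unif_real_le (S := {u | x ∈ midRegion 0 1 τ c u}) (p := 0) (q := x / (1 - τ))
          (by positivity) fun u hu hu' => ⟨hu.1.le, by
            rw [mem_ofPred_eq] at hu'
            rcases le_or_gt u c with huc | huc
            · rw [midRegion_of_le huc] at hu'
              have := hu'.1.1
              rw [le_div_iff₀ h1']
              linarith
            · exfalso
              rw [midRegion_of_gt huc] at hu'
              have h2 := hu'.1.1
              have h3 : c * τ * (1 - u) / (1 - c) ≤ c * τ := by
                rw [div_le_iff₀ hd]
                exact mul_le_mul_of_nonneg_left (by linarith) (by positivity)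
              linarith⟩
        simpa using this
      have h2 := hout x hx0 hxc
      have h3 : x * L ≤ τ * c / 4 := by
        have : x < τ * c / (4 * L) := by linarith
        rw [lt_div_iff₀ (by positivity)] at this
        linarith
      have h4 : x * L = x * K + x / (1 - τ) := by rw [hL]; ring
      linarith
    · rintro x ⟨hx0, hx1⟩
      have hx : 0 < x := by linarith
      have h2 := le_unif_real (S := midRegion 0 1 τ c x) (p := x - τ * x) (q := x)
        (by nlinarith) (by linarith) fun u hu => by
          rw [midRegion_of_le hx1.le]
          have h5 : 0 < τ * (1 - c) * x / c := by positivity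
          have h6 : 0 < x - τ * x := by nlinarith
          exact ⟨⟨hu.1, by linarith [hu.2]⟩, by linarith [hu.1], by linarith [hu.2]⟩
      have h3 : (0 : ℝ) ≤ (unif 0 1).real {u | x ∈ midRegion 0 1 τ c u} := measureReal_nonneg
      nlinarith
  · set D : ℝ := 1 - c + c * τ with hD
    have hDpos : 0 < D := by positivity
    -- For `u > c` the left end of the region of `u`, before intersecting with `(0, 1)`, is 0
    -- exactly at `u = 1 - θ`; points to the right of that miss a neighbourhood of 0.
    set θ : ℝ := (1 - c) / D with hθ
    have hθ0 : 0 < θ := by positivity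
    have hθ1 : θ < 1 := by
      rw [hθ, div_lt_one hDpos]
      have : 0 < c * τ := by positivity
      linarith
    have hDθ : D * θ = 1 - c := by rw [hθ]; field_simp
    -- This amounts to `1 ≤ D`, that is `1 ≤ τ`; it puts all points `u ≤ c` within the bound `x + (1
    -- - θ)` on in-arcs.
    have hcθ : c ≤ 1 - θ := by
      rw [le_sub_comm, hθ, div_le_iff₀ hDpos]
      nlinarith [mul_nonneg hc.le (mul_nonneg hd.le (sub_nonneg.2 h1))]
    set ε : ℝ := min c (θ / (2 * (K + 1))) with hε
    have hε0 : 0 < ε := lt_min hc (by positivity)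
    have hε1 : ε ≤ c := min_le_left _ _
    have hε2 : ε ≤ θ / (2 * (K + 1)) := min_le_right _ _
    refine arcCov_pos hN (p := 0) (q := ε) (p' := c * (1 - θ / 4)) (q' := c) (α := 1 - θ / 2)
      (β := 1 - θ / 4) le_rfl hε0 (by linarith) (by nlinarith) (by nlinarith) hc'.le
      (by linarith) ?_ ?_
    · rintro x ⟨hx0, hx1⟩
      have hxc : x ≤ c := by linarith
      have hin : (unif 0 1).real {u | x ∈ midRegion 0 1 τ c u} ≤ x + (1 - θ) := by
        have := unif_real_le (S := {u | x ∈ midRegion 0 1 τ c u}) (p := 0) (q := x + (1 - θ))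
          (by linarith) fun u hu hu' => ⟨hu.1.le, by
            rw [mem_ofPred_eq] at hu'
            rcases le_or_gt u c with huc | huc
            · linarith
            · rw [midRegion_of_gt huc] at hu'
              have h2 := hu'.1.1
              rw [sub_lt_comm, lt_div_iff₀ hd] at h2
              refine le_of_mul_le_mul_left (a := D) ?_ hDpos
              have h5 : D * (x + (1 - θ)) = D * x + c * τ := by
                rw [mul_add, mul_sub, hDθ, hD]; ring
              have h6 : (1 - c) * x ≤ D * x := by
                apply mul_le_mul_of_nonneg_right _ hx0.le
                have : 0 < c * τ := by positivity
                linarith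
              rw [h5]
              have h7 : D * u = (1 - c) * u + c * τ * u := by rw [hD]; ring
              rw [h7]
              linarith⟩
        simpa using this
      have h2 := hout x hx0 hxc
      have h3 : x * (K + 1) ≤ θ / 2 := by
        have : x < θ / (2 * (K + 1)) := by linarith
        rw [lt_div_iff₀ (by positivity)] at this
        linarith
      linarith
    · rintro x ⟨hx0, hx1⟩
      have hx : 0 < x := lt_trans (by apply mul_pos hc; linarith) hx0
      have hxc : x / c < 1 := (div_lt_one hc).2 hx1
      have hxc' : 1 - θ / 4 < x / c := by rw [lt_div_iff₀ hc]; linarith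
      have h2 := le_unif_real (S := midRegion 0 1 τ c x) (p := 0) (q := x / c) le_rfl hxc.le
        fun u hu => by
          rw [midRegion_of_le hx1.le]
          -- At `τ = 1` the right end of the region is exactly `x / c`; larger `τ` only moves it to
          -- the right.
          have h5 : x / c ≤ x + τ * (1 - c) * x / c := by
            have e : x + τ * (1 - c) * x / c - x / c = (τ - 1) * (1 - c) * x / c := by
              field_simp; ring
            have : 0 ≤ (τ - 1) * (1 - c) * x / c :=
              div_nonneg (mul_nonneg (mul_nonneg (by linarith) hd.le) hx.le) hc.le
            linarith
          have h6 : x - τ * x ≤ 0 := by nlinarith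
          exact ⟨⟨by linarith [hu.1], by linarith [hu.2]⟩, hu.1, by linarith [hu.2]⟩
      have h3 : (0 : ℝ) ≤ (unif 0 1).real {u | x ∈ midRegion 0 1 τ c u} := measureReal_nonneg
      linarith

end CentralSimilarity

/-! ### The cells of the partition and the assembly of the theorem. -/

namespace CentralSimilarity

open UStatistic

variable {δ₁ δ₂ : ℝ} {Y : Finset ℝ}

lemma orderStat_zero : orderStat δ₁ δ₂ Y 0 = δ₁ := by simp [orderStat]

lemma orderStat_card_add_one : orderStat δ₁ δ₂ Y (Y.card + 1) = δ₂ := by simp [orderStat]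

lemma orderStat_of_mem {i : ℕ} (h1 : 1 ≤ i) (h2 : i ≤ Y.card) :
    orderStat δ₁ δ₂ Y i = Y.orderEmbOfFin rfl ⟨i - 1, by omega⟩ := by
  rw [orderStat, if_neg (by omega), dif_pos (by omega)]

lemma orderStat_mem_Ioo (hY : ∀ y ∈ Y, δ₁ < y ∧ y < δ₂) {i : ℕ} (h1 : 1 ≤ i) (h2 : i ≤ Y.card) :
    δ₁ < orderStat δ₁ δ₂ Y i ∧ orderStat δ₁ δ₂ Y i < δ₂ := by
  rw [orderStat_of_mem h1 h2]
  exact hY _ (Finset.orderEmbOfFin_mem _ _ _)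

lemma orderStat_lt {i : ℕ} (h1 : 2 ≤ i) (h2 : i ≤ Y.card) :
    orderStat δ₁ δ₂ Y (i - 1) < orderStat δ₁ δ₂ Y i := by
  rw [orderStat_of_mem (by omega) (by omega), orderStat_of_mem (by omega) h2]
  refine (Y.orderEmbOfFin rfl).strictMono ?_
  rw [Fin.mk_lt_mk]
  omega

lemma proxRegion_left (τ c : ℝ) :
    proxRegion δ₁ δ₂ Y τ c 1 = leftEndRegion (orderStat δ₁ δ₂ Y 1) τ := by
  funext x
  simp [proxRegion]

lemma proxRegion_right (hne : Y.Nonempty) (τ c : ℝ) :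
    proxRegion δ₁ δ₂ Y τ c (Y.card + 1) = rightEndRegion (orderStat δ₁ δ₂ Y Y.card) τ := by
  funext x
  have := hne.card_pos
  rw [proxRegion, if_neg (by omega), if_pos rfl]

lemma proxRegion_mid (τ c : ℝ) {i : ℕ} (h1 : 2 ≤ i) (h2 : i ≤ Y.card) :
    proxRegion δ₁ δ₂ Y τ c i =
      midRegion (orderStat δ₁ δ₂ Y (i - 1)) (orderStat δ₁ δ₂ Y i) τ c := by
  funext x
  rw [proxRegion, if_neg (by omega), if_neg (by omega)]

variable {Ω : Type*} [MeasurableSpace Ω] {P : Measure Ω} [IsProbabilityMeasure P]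
  {X : ℕ → Ω → ℝ} {τ c : ℝ} {i : ℕ}

/-- Conditional mean and asymptotic normality on one interval of the partition. -/
lemma limits_of_cell (hδ : δ₁ < δ₂) (hmeas : ∀ k, Measurable (X k)) (hindep : iIndepFun X P)
    (hunif : ∀ k, pdf.IsUniform (X k) (Ioo δ₁ δ₂) P volume)
    (hN : MeasurableSet {p : ℝ × ℝ | p.2 ∈ proxRegion δ₁ δ₂ Y τ c i p.1})
    (ha : δ₁ ≤ orderStat δ₁ δ₂ Y (i - 1)) (hb : orderStat δ₁ δ₂ Y i ≤ δ₂)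
    (hab : orderStat δ₁ δ₂ Y (i - 1) < orderStat δ₁ δ₂ Y i)
    (hint : δ₁ < orderStat δ₁ δ₂ Y (i - 1) ∧ orderStat δ₁ δ₂ Y (i - 1) < δ₂ ∨
      δ₁ < orderStat δ₁ δ₂ Y i ∧ orderStat δ₁ δ₂ Y i < δ₂) {μ ν : ℝ}
    (hμ : arcProb (proxRegion δ₁ δ₂ Y τ c i) (orderStat δ₁ δ₂ Y (i - 1))
      (orderStat δ₁ δ₂ Y i) = μ)
    (hν : arcCov (proxRegion δ₁ δ₂ Y τ c i) (orderStat δ₁ δ₂ Y (i - 1))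
      (orderStat δ₁ δ₂ Y i) = ν) :
    CondMeanEq P X δ₁ δ₂ Y τ c i μ ∧ CondNormalLimit P X δ₁ δ₂ Y τ c i μ (4 * ν) ∧
      NormalLimit P X δ₁ δ₂ Y τ c i μ (4 * ν) := by
  have := isProbabilityMeasure_unif hδ
  have := isProbabilityMeasure_unif hab
  have hC : MeasurableSet (cell δ₁ δ₂ Y i) := measurableSet_Ioo
  have h1 : unif δ₁ δ₂ (cell δ₁ δ₂ Y i) ≠ 0 := unif_Ioo_ne_zero ha hb hab
  have h2 : unif δ₁ δ₂ (cell δ₁ δ₂ Y i)ᶜ ≠ 0 := unif_compl_Ioo_ne_zero hint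
  have hQ : ProbabilityTheory.cond (unif δ₁ δ₂) (cell δ₁ δ₂ Y i) =
      unif (orderStat δ₁ δ₂ Y (i - 1)) (orderStat δ₁ δ₂ Y i) := cond_unif ha hb
  -- `pdf.IsUniform` and `unif` unfold to the same conditioned Lebesgue measure.
  have hlaw : ∀ k, P.map (X k) = unif δ₁ δ₂ := hunif
  rw [arcCov_eq_variance_proj hN hab] at hν
  subst hν hμ
  refine ⟨fun n k hk hkn => ?_, fun s k hks hk f => ?_, ?_⟩
  · have h := integral_cond_densityIn hN hC hmeas hindep hlaw h1 h2 hkn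
      (F := fun _ t => t) fun _ => measurable_id
    rw [hQ, integral_arcStat hN hk] at h
    exact h
  · exact tendsto_integral_cond_densityIn hN hC hmeas hindep hlaw h1 h2 hQ hks hk f
  · exact tendstoInDistribution_densityIn hN hC hmeas hindep hlaw h1 h2 hQ

end CentralSimilarity
end

theorem mainTheorem9 {Ω : Type*} [MeasurableSpace Ω] (P : Measure Ω) [IsProbabilityMeasure P]
    (δ₁ δ₂ : ℝ) (hδ : δ₁ < δ₂)
    (Y : Finset ℝ) (hne : Y.Nonempty) (hY : ∀ y ∈ Y, δ₁ < y ∧ y < δ₂)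
    (τ c : ℝ) (hτ : 0 < τ) (hc : 0 < c) (hc' : c < 1)
    (X : ℕ → Ω → ℝ) (hmeas : ∀ k, Measurable (X k)) (hindep : iIndepFun X P)
    (hunif : ∀ k, pdf.IsUniform (X k) (Ioo δ₁ δ₂) P volume) :
    (∀ i : ℕ, 2 ≤ i → i ≤ Y.card →
      CentralSimilarity.arcProb (CentralSimilarity.proxRegion δ₁ δ₂ Y τ c i)
          (CentralSimilarity.orderStat δ₁ δ₂ Y (i - 1)) (CentralSimilarity.orderStat δ₁ δ₂ Y i)
        = CentralSimilarity.mu τ c ∧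
      CentralSimilarity.arcCov (CentralSimilarity.proxRegion δ₁ δ₂ Y τ c i)
          (CentralSimilarity.orderStat δ₁ δ₂ Y (i - 1)) (CentralSimilarity.orderStat δ₁ δ₂ Y i)
        = CentralSimilarity.nu τ c ∧
      0 < CentralSimilarity.nu τ c ∧
      CentralSimilarity.CondMeanEq P X δ₁ δ₂ Y τ c i (CentralSimilarity.mu τ c) ∧
      CentralSimilarity.CondNormalLimit P X δ₁ δ₂ Y τ c i
        (CentralSimilarity.mu τ c) (4 * CentralSimilarity.nu τ c) ∧
      CentralSimilarity.NormalLimit P X δ₁ δ₂ Y τ c i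
        (CentralSimilarity.mu τ c) (4 * CentralSimilarity.nu τ c)) ∧
    (∀ i : ℕ, i = 1 ∨ i = Y.card + 1 →
      CentralSimilarity.arcProb (CentralSimilarity.proxRegion δ₁ δ₂ Y τ c i)
          (CentralSimilarity.orderStat δ₁ δ₂ Y (i - 1)) (CentralSimilarity.orderStat δ₁ δ₂ Y i)
        = CentralSimilarity.muEnd τ ∧
      CentralSimilarity.arcCov (CentralSimilarity.proxRegion δ₁ δ₂ Y τ c i)
          (CentralSimilarity.orderStat δ₁ δ₂ Y (i - 1)) (CentralSimilarity.orderStat δ₁ δ₂ Y i)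
        = CentralSimilarity.nuEnd τ ∧
      0 < CentralSimilarity.nuEnd τ ∧
      CentralSimilarity.CondMeanEq P X δ₁ δ₂ Y τ c i (CentralSimilarity.muEnd τ) ∧
      CentralSimilarity.CondNormalLimit P X δ₁ δ₂ Y τ c i
        (CentralSimilarity.muEnd τ) (4 * CentralSimilarity.nuEnd τ) ∧
      CentralSimilarity.NormalLimit P X δ₁ δ₂ Y τ c i
        (CentralSimilarity.muEnd τ) (4 * CentralSimilarity.nuEnd τ)) := by
  open CentralSimilarity in
  refine ⟨fun i h1 h2 => ?_, fun i hi => ?_⟩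
  · have hab := orderStat_lt (δ₁ := δ₁) (δ₂ := δ₂) h1 h2
    have ha := orderStat_mem_Ioo hY (i := i - 1) (by omega) (by omega)
    have hb := orderStat_mem_Ioo hY (i := i) (by omega) h2
    have hN : MeasurableSet {p : ℝ × ℝ | p.2 ∈ proxRegion δ₁ δ₂ Y τ c i p.1} := by
      rw [proxRegion_mid τ c h1 h2]
      exact measurableSet_midRegion _ _ _ _
    have hiff : ∀ s ∈ Ioo (0 : ℝ) 1, ∀ t ∈ Ioo (0 : ℝ) 1,
        orderStat δ₁ δ₂ Y (i - 1) + (orderStat δ₁ δ₂ Y i - orderStat δ₁ δ₂ Y (i - 1)) * t ∈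
          proxRegion δ₁ δ₂ Y τ c i (orderStat δ₁ δ₂ Y (i - 1) +
            (orderStat δ₁ δ₂ Y i - orderStat δ₁ δ₂ Y (i - 1)) * s) ↔
          t ∈ midRegion 0 1 τ c s := fun s _ t _ => by
      rw [proxRegion_mid τ c h1 h2]
      exact mem_midRegion_affine hab τ c s t
    have hμ := arcProb_transport hN (measurableSet_midRegion 0 1 τ c) hab (by fun_prop)
      (map_unif_increasing hab) hiff
    have hν := arcCov_transport hN (measurableSet_midRegion 0 1 τ c) hab (by fun_prop)
      (map_unif_increasing hab) hiff
    exact ⟨hμ, hν, nu_pos hτ hc hc', limits_of_cell hδ hmeas hindep hunif hN ha.1.le hb.2.le hab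
      (Or.inl ha) hμ hν⟩
  · have hcard : 1 ≤ Y.card := hne.card_pos
    rcases hi with rfl | rfl
    · have hb := orderStat_mem_Ioo hY (i := 1) le_rfl hcard
      -- The first cell starts at `δ₁`, which is not interior, so its right endpoint supplies the
      -- positive mass outside the cell.
      have ha : orderStat δ₁ δ₂ Y (1 - 1) = δ₁ := orderStat_zero
      have hab : orderStat δ₁ δ₂ Y (1 - 1) < orderStat δ₁ δ₂ Y 1 := ha.trans_lt hb.1
      have hN : MeasurableSet {p : ℝ × ℝ | p.2 ∈ proxRegion δ₁ δ₂ Y τ c 1 p.1} := by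
        rw [proxRegion_left τ c]
        exact measurableSet_leftEndRegion _ _
      have hiff : ∀ s ∈ Ioo (0 : ℝ) 1, ∀ t ∈ Ioo (0 : ℝ) 1,
          orderStat δ₁ δ₂ Y 1 + -(orderStat δ₁ δ₂ Y 1 - orderStat δ₁ δ₂ Y (1 - 1)) * t ∈
            proxRegion δ₁ δ₂ Y τ c 1 (orderStat δ₁ δ₂ Y 1 +
              -(orderStat δ₁ δ₂ Y 1 - orderStat δ₁ δ₂ Y (1 - 1)) * s) ↔
            t ∈ rightEndRegion 0 τ s := fun s _ t _ => by
        rw [proxRegion_left τ c]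
        exact mem_leftEndRegion_affine hab τ s t
      have hμ := arcProb_transport hN (measurableSet_rightEndRegion 0 τ) hab (by fun_prop)
        (map_unif_decreasing hab) hiff
      have hν := arcCov_transport hN (measurableSet_rightEndRegion 0 τ) hab (by fun_prop)
        (map_unif_decreasing hab) hiff
      exact ⟨hμ, hν, nuEnd_pos hτ, limits_of_cell hδ hmeas hindep hunif hN ha.ge hb.2.le hab
        (Or.inr hb) hμ hν⟩
    · have ha : δ₁ < orderStat δ₁ δ₂ Y (Y.card + 1 - 1) ∧
          orderStat δ₁ δ₂ Y (Y.card + 1 - 1) < δ₂ := orderStat_mem_Ioo hY hcard le_rfl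
      have hb : orderStat δ₁ δ₂ Y (Y.card + 1) = δ₂ := orderStat_card_add_one
      have hab := ha.2.trans_eq hb.symm
      have hN : MeasurableSet {p : ℝ × ℝ | p.2 ∈ proxRegion δ₁ δ₂ Y τ c (Y.card + 1) p.1} := by
        rw [proxRegion_right hne τ c]
        exact measurableSet_rightEndRegion _ _
      have hiff : ∀ s ∈ Ioo (0 : ℝ) 1, ∀ t ∈ Ioo (0 : ℝ) 1,
          orderStat δ₁ δ₂ Y (Y.card + 1 - 1) +
              (orderStat δ₁ δ₂ Y (Y.card + 1) - orderStat δ₁ δ₂ Y (Y.card + 1 - 1)) * t ∈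
            proxRegion δ₁ δ₂ Y τ c (Y.card + 1) (orderStat δ₁ δ₂ Y (Y.card + 1 - 1) +
              (orderStat δ₁ δ₂ Y (Y.card + 1) - orderStat δ₁ δ₂ Y (Y.card + 1 - 1)) * s) ↔
            t ∈ rightEndRegion 0 τ s := fun s _ t _ => by
        rw [proxRegion_right hne τ c]
        exact mem_rightEndRegion_affine hab τ s t
      have hμ := arcProb_transport hN (measurableSet_rightEndRegion 0 τ) hab (by fun_prop)
        (map_unif_increasing hab) hiff
      have hν := arcCov_transport hN (measurableSet_rightEndRegion 0 τ) hab (by fun_prop)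
        (map_unif_increasing hab) hiff
      exact ⟨hμ, hν, nuEnd_pos hτ, limits_of_cell hδ hmeas hindep hunif hN ha.1.le hb.le hab
        (Or.inl ha) hμ hν⟩
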